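/- Let $n\ge 4$, let $B_r\subset\mathbb{R}^n$ be the open ball of radius $r$ centred at the origin, and let $f=f(x,z,p)$ be a positive $C^{1,1}$ function on $B_3\times\mathbb{R}\times\mathbb{R}^n$ with finite norms $\|f\|_{C^{1,1}}=\sup|f|+\sup|Df|+[Df]_{\mathrm{Lip}}$ and $\|1/f\|_{L^\infty}$, both taken over $B_3\times\mathbb{R}\times\mathbb{R}^n$. Let $u\in C^\infty(B_3)$ be an admissible (2-convex) solution of $$\sigma_2(\lambda(D^2u))=\sum_{i<j}\lambda_i\lambda_j=f(x,u,Du)\quad\text{on }B_3,$$ that is, the eigenvalues $\lambda=(\lambda_1,\dots,\lambda_n)$ of $D^2u(x)$ satisfy $\sigma_1(\lambda)>0$ and $\sigma_2(\lambda)>0$ at every $x\in B_3$, with $\|u\|_{C^1(B_3)}=\sup_{B_3}|u|+\sup_{B_3}|Du|<\infty$. If $n\ge 5$, assume in addition the dynamic semi-convexity condition $$\lambda_{\min}(D^2u)\ge -c(n)\,\Delta u\ \text{ on }B_3,\qquad c(n)=\frac{\sqrt{3n^2+1}-n+1}{2n},$$ where $\lambda_{\min}(D^2u)$ is the minimum eigenvalue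 of $D^2u$. Then $\Delta u$ is bounded above on $B_2$ and $$\sup_{B_2}\Delta u\le C\exp\!\left(C\|u\|_{C^1(B_3)}^{6}\right)\sup_{B_1}\Delta u,$$ where $C>0$ depends only on $n$ and on upper bounds for $\|f\|_{C^{1,1}}$ and $\|1/f\|_{L^\infty}$. -/

import Mathlib

open scoped ENNReal NNReal ContDiff Gradient InnerProductSpace Laplacian

namespace SigmaTwo

noncomputable section

/-- The Euclidean space `ℝⁿ`. -/
abbrev E (n : ℕ) : Type := EuclideanSpace ℝ (Fin n)

/-! ### Norms, with values in `[0, ∞]` -/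

/-- The supremum norm `sup_U ‖g‖`. On an open set and for a continuous `g` it is the `L^∞` norm. -/
def supNorm {X Y : Type*} [NormedAddCommGroup Y] (g : X → Y) (U : Set X) : ℝ≥0∞ :=
  ⨆ x ∈ U, ‖g x‖ₑ

/-- The Lipschitz seminorm of `g` on `U`, i.e. the supremum of `‖g x - g y‖ / ‖x - y‖`
(the diagonal contributes `0 / 0 = 0`). -/
def lipSeminorm {X Y : Type*} [NormedAddCommGroup X] [NormedAddCommGroup Y]
    (g : X → Y) (U : Set X) : ℝ≥0∞ :=
  ⨆ x ∈ U, ⨆ y ∈ U, ‖g x - g y‖ₑ / ‖x - y‖ₑ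

/-- The `C¹` norm `sup_U |u| + sup_U |Du|`. -/
def c1Norm {n : ℕ} (u : E n → ℝ) (U : Set (E n)) : ℝ≥0∞ :=
  supNorm u U + supNorm (∇ u) U

/-- The `C^{1,1}` norm `sup_U |g| + sup_U |Dg| + [Dg]_{Lip(U)}` of a function that is
differentiable at all points of the open set `U`. -/
def c11Norm {X : Type*} [NormedAddCommGroup X] [NormedSpace ℝ X] (g : X → ℝ) (U : Set X) : ℝ≥0∞ :=
  supNorm g U + supNorm (fderiv ℝ g) U + lipSeminorm (fderiv ℝ g) U

/-- `g` is a `C^{1,1}` function on the open set `U`: it is differentiable at the points of `U`, and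
`g` and `Dg` are bounded and `Dg` is Lipschitz on `U`. -/
def IsC11On {X : Type*} [NormedAddCommGroup X] [NormedSpace ℝ X] (g : X → ℝ) (U : Set X) : Prop :=
  (∀ x ∈ U, DifferentiableAt ℝ g x) ∧ c11Norm g U ≠ ⊤

/-! ### The Hessian and its eigenvalues -/

/-- The Hessian matrix `D²u(x) = (∂ᵢ∂ⱼu(x))`. -/
def hessian {n : ℕ} (u : E n → ℝ) (x : E n) : Matrix (Fin n) (Fin n) ℝ :=
  Matrix.of fun i j =>
    iteratedFDeriv ℝ 2 u x ![EuclideanSpace.single i 1, EuclideanSpace.single j 1]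

/-- The eigenvalues of `D²u(x)`, repeated according to multiplicity: the roots of its
characteristic polynomial (all `n` of them are real where `D²u(x)` is symmetric). -/
def hessianEigenvalues {n : ℕ} (u : E n → ℝ) (x : E n) : Multiset ℝ :=
  (hessian u x).charpoly.roots

/-- `σ_k(λ(D²u(x)))`, the `k`-th elementary symmetric function of the eigenvalues of `D²u(x)`. -/
def sigma (k : ℕ) {n : ℕ} (u : E n → ℝ) (x : E n) : ℝ :=
  (hessianEigenvalues u x).esymm k

/-- The minimum eigenvalue of `D²u(x)`. -/
def lambdaMin {n : ℕ} (u : E n → ℝ) (x : E n) : ℝ :=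
  sInf {μ : ℝ | μ ∈ hessianEigenvalues u x}

/-! ### The equation -/

/-- `u` is 2-convex on `U`: `λ(D²u(x)) ∈ Γ₂ = {σ₁ > 0, σ₂ > 0}` at each point of `U`. -/
def IsTwoConvexOn {n : ℕ} (u : E n → ℝ) (U : Set (E n)) : Prop :=
  ∀ x ∈ U, 0 < sigma 1 u x ∧ 0 < sigma 2 u x

/-- `u` is a smooth admissible (2-convex) solution of `σ₂(λ(D²u)) = f(x, u, Du)` on the
open set `U`. -/
structure IsSmoothAdmissibleSolution {n : ℕ} (f : E n × ℝ × E n → ℝ) (u : E n → ℝ)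
    (U : Set (E n)) : Prop where
  smooth : ContDiffOn ℝ ∞ u U
  admissible : IsTwoConvexOn u U
  equation : ∀ x ∈ U, sigma 2 u x = f (x, u x, ∇ u x)

/-- The constant `c(n) = (√(3n² + 1) - n + 1) / (2n)`. -/
def dynConst (n : ℕ) : ℝ := (√(3 * (n : ℝ) ^ 2 + 1) - n + 1) / (2 * n)

/-- The dynamic semi-convexity condition `λ_min(D²u) ≥ -c(n) Δu` on `U`. -/
def IsDynSemiconvexOn {n : ℕ} (u : E n → ℝ) (U : Set (E n)) : Prop :=
  ∀ x ∈ U, -dynConst n * Δ u x ≤ lambdaMin u x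

end

end SigmaTwo

namespace SigmaTwo

/-! ### Algebra of the second elementary symmetric function -/

/-! The bound comes from the maximum principle for ρ² exp(α(x·Du − u) + β|Du|²/2)(log Δu − m) on the
ball of radius 5/2, with ρ = 25/4 − |x|² and m = log sup_{B_1} Δu (`laplacian_le_of_smooth`). The
last factor is nonpositive on B_1 and ρ vanishes on the boundary, so a positive maximum sits at some
p with 1 ≤ |p| < 5/2. If Δu were too large somewhere in B_2, then bρ² ≥ KΓ² at p, where b = log
Δu(p) − m and Γ = 1 + ‖u‖_{C¹}; `not_isLocalMax_of_large` excludes this.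

Work in an eigenframe at p, with σ = Δu, linearized coefficients σ − λ_k, and g_k = ∂_kΔu/(σb). The
engine is an almost Jacobi inequality for log Δu (`almost_jacobi`), resting on the third-derivative
estimate `third_order_ge`, which has a gain (c(n) + λ_k/σ)/22. Dynamic semi-convexity says that this
gain is nonnegative; in dimension four it follows from 2-convexity (`neg_half_sum_le`).
Differentiating log b twice costs −b g_k² − g_k²: the Jacobi inequality cancels the first term, and
b times the gain is there to absorb the second.

The resulting upper bound `critical_point_ineq` contradicts the lower bound `critical_point_bound`,
which has three cases. If some λ_m ≤ −σ/8, the term β Σ (σ − λ_k)λ_k² has order βσ³ and wins.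
Otherwise the gain is bounded below, and |p| ≥ 1 provides a direction k with n x_k² ≥ 1, to which
the first-order condition g_k = 4x_k/ρ − (αx_k + βu_k)λ_k is applied. If k is not the top direction,
then σ − λ_k ≥ σ/4, and g_k or λ_k must account for 4x_k/ρ. If k is the top direction, σ − λ_k may
be as small as 1/(Lσ), but λ_k ≥ σ/n and the dominance of α over β force |g_k| to grow linearly in
σ. -/

lemma dynConst_quadratic {n : ℕ} (hn : 0 < n) :
    2 * n * dynConst n ^ 2 + (2 * n - 2) * dynConst n = n + 1 := by
  have hn' : (0 : ℝ) < n := by exact_mod_cast hn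
  have h := Real.sq_sqrt (show (0 : ℝ) ≤ 3 * (n : ℝ) ^ 2 + 1 by positivity)
  unfold dynConst
  generalize √(3 * (n : ℝ) ^ 2 + 1) = r at *
  field_simp
  nlinarith

lemma le_dynConst {n : ℕ} (hn : 4 ≤ n) : 1 / 4 + 1 / (n : ℝ) ≤ dynConst n := by
  have hn' : (4 : ℝ) ≤ n := by exact_mod_cast hn
  have h : 3 * (n : ℝ) / 2 + 1 ≤ √(3 * (n : ℝ) ^ 2 + 1) := by
    apply Real.le_sqrt_of_sq_le
    nlinarith
  unfold dynConst
  generalize √(3 * (n : ℝ) ^ 2 + 1) = r at *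
  have h1 : 1 / (n : ℝ) * (2 * n) = 2 := by field_simp
  rw [le_div_iff₀ (by positivity), add_mul, h1]
  linarith

lemma dynConst_le_half {n : ℕ} (hn : 4 ≤ n) : dynConst n ≤ 1 / 2 := by
  have hn' : (4 : ℝ) ≤ n := by exact_mod_cast hn
  have h : √(3 * (n : ℝ) ^ 2 + 1) ≤ 2 * n - 1 := by
    rw [Real.sqrt_le_left (by linarith)]
    nlinarith
  unfold dynConst
  rw [div_le_iff₀ (by positivity)]
  linarith

lemma dynConst_four : dynConst 4 = 1 / 2 := by
  have h : √(3 * ((4 : ℕ) : ℝ) ^ 2 + 1) = 7 := by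
    rw [show 3 * ((4 : ℕ) : ℝ) ^ 2 + 1 = 7 ^ 2 by norm_num]
    exact Real.sqrt_sq (by norm_num)
  unfold dynConst
  rw [h]
  norm_num

/-- In dimension four every 2-convex vector satisfies the dynamic semi-convexity condition. -/
lemma neg_half_sum_le {lam : Fin 4 → ℝ} {σ h : ℝ} (hσ : σ = ∑ i, lam i) (hσ0 : 0 < σ)
    (hh : 2 * h = σ ^ 2 - ∑ i, lam i ^ 2) (h0 : 0 < h) (k : Fin 4) :
    -(1 / 2) * σ ≤ lam k := by
  have key : ∀ a b c d : ℝ, σ = a + b + c + d → 2 * h = σ ^ 2 - (a ^ 2 + b ^ 2 + c ^ 2 + d ^ 2) →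
      -(1 / 2) * σ ≤ a := by
    intro a b c d h1 h2
    -- The other three squares sum to at least (σ − a)²/3, so a < −σ/2 would push the sum of all
    -- squares above σ².
    by_contra! hlt
    nlinarith [sq_nonneg (b - c), sq_nonneg (b - d), sq_nonneg (c - d)]
  rw [Fin.sum_univ_four] at hσ hh
  fin_cases k
  · exact key (lam 0) (lam 1) (lam 2) (lam 3) hσ hh
  · exact key (lam 1) (lam 0) (lam 2) (lam 3) (by linarith) (by linarith)
  · exact key (lam 2) (lam 0) (lam 1) (lam 3) (by linarith) (by linarith)
  · exact key (lam 3) (lam 0) (lam 1) (lam 2) (by linarith) (by linarith)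

/-- Entries with three distinct indices are dropped. Each T i i k with i ≠ k occurs in three
positions and T k k k in only one, hence the correction by 2. -/
lemma sum_sq_symm_ge {n : ℕ} {T : Fin n → Fin n → Fin n → ℝ}
    (h₁ : ∀ i j k, T i j k = T j i k) (h₂ : ∀ i j k, T i j k = T i k j) :
    ∑ k, (3 * ∑ i, T i i k ^ 2 - 2 * T k k k ^ 2) ≤ ∑ k, ∑ i, ∑ j, T i j k ^ 2 := by
  have hpt : ∀ i j k, (if i = j then T i i k ^ 2 else 0) + (if j = k then T j j i ^ 2 else 0) +
      (if i = k then T i i j ^ 2 else 0) - (if i = j then if j = k then 2 * T k k k ^ 2 else 0 else 0)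
      ≤ T i j k ^ 2 := by
    intro i j k
    by_cases hij : i = j
    · subst hij
      by_cases hjk : i = k
      · subst hjk; simp; linarith
      · simp [hjk]
    · by_cases hjk : j = k
      · subst hjk
        have : T j j i = T i j j := by rw [h₂ j j i, h₁ j i j]
        simp [hij, this]
      · by_cases hik : i = k
        · subst hik
          simp [hij, hjk, h₂ i j i]
        · simp [hij, hjk, hik]; positivity
  have h := Finset.sum_le_sum fun k (_ : k ∈ Finset.univ) =>
    Finset.sum_le_sum fun i (_ : i ∈ Finset.univ) =>
      Finset.sum_le_sum fun j (_ : j ∈ Finset.univ) => hpt i j k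
  refine le_trans (le_of_eq ?_) h
  simp only [Finset.sum_sub_distrib, Finset.sum_add_distrib, Finset.sum_ite_eq, Finset.sum_ite_eq',
    Finset.mem_univ, if_true, ← Finset.mul_sum]
  have e1 : ∑ k, ∑ i, ∑ j, (if i = k then T i i j ^ 2 else 0) = ∑ k, ∑ i, T i i k ^ 2 := by
    rw [Finset.sum_comm]
    have : ∀ i, ∑ k, ∑ j, (if i = k then T i i j ^ 2 else 0) = ∑ j, T i i j ^ 2 := by
      intro i
      rw [Finset.sum_comm]
      simp
    simp_rw [this]
    exact Finset.sum_comm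
  have e2 : ∑ k, ∑ i, T k k i ^ 2 = ∑ k, ∑ i, T i i k ^ 2 := Finset.sum_comm
  rw [e1, e2]
  ring

/-- Without the gain, right side minus left side factors as (1 + c − s) · 2(ns + nc − 1), because
the quadratic for c makes s = 1 + c a root. The second factor is at least n/2 since nc − 1 ≥ n/4,
while the quadratic in s is at most 11n; this leaves room for the gain with denominator 22. -/
lemma ratio_bound {n c s : ℝ} (hn : 4 ≤ n) (hc : 2 * n * c ^ 2 + (2 * n - 2) * c = n + 1)
    (hc1 : 1 / 4 + 1 / n ≤ c) (hc2 : c ≤ 1 / 2) (hs0 : 0 < s) (hsc : s ≤ 1 + c) :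
    (2 * n * s ^ 2 - 4 * (n - 1) * s + 3 * (n - 1)) * (1 + (1 + c - s) / 22) ≤
      4 * (n - 1) - 2 * (n - 3) * s := by
  have hn1 : 1 ≤ (c - 1 / 4) * n := by
    have : 1 / n ≤ c - 1 / 4 := by linarith
    rwa [div_le_iff₀ (by linarith)] at this
  obtain ⟨D, hD⟩ : ∃ D : ℝ, D = 2 * n * s ^ 2 - 4 * (n - 1) * s + 3 * (n - 1) := ⟨_, rfl⟩
  have h1 : D ≤ 11 * n := by
    have hs2 : s ^ 2 ≤ 4 := by nlinarith
    rw [hD]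
    nlinarith
  have h2 : 4 * (n - 1) - 2 * (n - 3) * s - D = (1 + c - s) * (2 * (n * s + n * c - 1)) := by
    rw [hD]
    linear_combination (-1) * hc
  have h3 : D * (1 + c - s) ≤ 22 * ((1 + c - s) * (2 * (n * s + n * c - 1))) := by
    have : D ≤ 44 * (n * s + n * c - 1) := by nlinarith [mul_pos (show 0 < n by linarith) hs0]
    nlinarith
  rw [← hD]
  linarith

/-! ### Pointwise inequalities for 2-convex eigenvalues and concavity on third derivatives -/

section TwoConvex

variable {n : ℕ} {lam : Fin n → ℝ} {σ h : ℝ}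

lemma sum_linearized (hσ : σ = ∑ i, lam i) : ∑ i, (σ - lam i) = (n - 1) * σ := by
  rw [Finset.sum_sub_distrib, ← hσ]
  simp
  ring

lemma sum_linearized_sq (hσ : σ = ∑ i, lam i) (hh : 2 * h = σ ^ 2 - ∑ i, lam i ^ 2) :
    ∑ i, (σ - lam i) ^ 2 = (n - 1) * σ ^ 2 - 2 * h := by
  have : ∀ i, (σ - lam i) ^ 2 = σ ^ 2 - 2 * σ * lam i + lam i ^ 2 := fun i => by ring
  simp_rw [this]
  rw [Finset.sum_add_distrib, Finset.sum_sub_distrib, ← Finset.mul_sum, ← hσ]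
  simp
  linarith

lemma abs_le_sum (hσ0 : 0 < σ) (hh : 2 * h = σ ^ 2 - ∑ i, lam i ^ 2) (h0 : 0 < h) (k : Fin n) :
    |lam k| ≤ σ := by
  have := Finset.single_le_sum (f := fun i => lam i ^ 2) (fun i _ => sq_nonneg _)
    (Finset.mem_univ k)
  apply abs_le_of_sq_le_sq _ hσ0.le
  linarith

/-- Factor 2h ≤ σ² − λ_k² and bound σ + λ_k by 2σ. -/
lemma div_le_linearized (hσ0 : 0 < σ) (hh : 2 * h = σ ^ 2 - ∑ i, lam i ^ 2) (h0 : 0 < h)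
    (k : Fin n) : h / σ ≤ σ - lam k := by
  have h1 := Finset.single_le_sum (f := fun i => lam i ^ 2) (fun i _ => sq_nonneg _)
    (Finset.mem_univ k)
  have h2 := abs_le.1 (abs_le_sum hσ0 hh h0 k)
  rw [div_le_iff₀ hσ0]
  have h3 : 2 * h ≤ (σ - lam k) * (σ + lam k) := by nlinarith
  nlinarith

/-- Two entries above 3σ/4 would have squares summing to more than σ². Thus only the top direction
can be degenerate. -/
lemma quarter_le_linearized (hσ0 : 0 < σ) (hh : 2 * h = σ ^ 2 - ∑ i, lam i ^ 2) (h0 : 0 < h)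
    {k m : Fin n} (hkm : k ≠ m) (hm : lam k ≤ lam m) : σ / 4 ≤ σ - lam k := by
  have h1 : lam k ^ 2 + lam m ^ 2 ≤ ∑ i, lam i ^ 2 := by
    rw [← Finset.sum_pair (f := fun i => lam i ^ 2) hkm]
    exact Finset.sum_le_sum_of_subset_of_nonneg (Finset.subset_univ _) fun i _ _ => sq_nonneg _
  by_contra! hlt
  nlinarith

set_option maxHeartbeats 800000 in
/-- Strict concavity of the linearized operator on third derivatives, with a controlled error
coming from the right-hand side. -/
lemma third_order_ge (hn : 4 ≤ n) (hσ : σ = ∑ i, lam i) (hσ0 : 0 < σ)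
    (hh : 2 * h = σ ^ 2 - ∑ i, lam i ^ 2) (h0 : 0 < h) (k : Fin n)
    (hk : -dynConst n * σ ≤ lam k) {y : Fin n → ℝ} {t q : ℝ} (ht : t = ∑ i, y i)
    (hq : q = ∑ i, (σ - lam i) * y i) :
    (σ - lam k) / σ * (1 + (dynConst n + lam k / σ) / 22) * t ^ 2 - 30 * |t| * |q| / σ ≤
      3 * ∑ i, y i ^ 2 - 2 * y k ^ 2 - t ^ 2 := by
  have hn' : (4 : ℝ) ≤ n := by exact_mod_cast hn
  have hc := dynConst_quadratic (show 0 < n by omega)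
  have hc1 := le_dynConst hn
  have hc2 := dynConst_le_half hn
  generalize dynConst n = c at *
  have hfk : 0 < σ - lam k := lt_of_lt_of_le (by positivity) (div_le_linearized hσ0 hh h0 k)
  obtain ⟨s, hs⟩ : ∃ s, s = (σ - lam k) / σ := ⟨_, rfl⟩
  have hs0 : 0 < s := by rw [hs]; positivity
  have hlk : lam k / σ = 1 - s := by rw [hs]; field_simp; ring
  have hsc : s ≤ 1 + c := by
    rw [hs, div_le_iff₀ hσ0]; linarith
  obtain ⟨N, hN⟩ : ∃ N : ℝ, N = 2 * s ^ 2 + n - 1 := ⟨_, rfl⟩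
  have hN0 : 0 < N := by nlinarith
  -- Subtracting a multiple of the known quantity q from t improves Cauchy–Schwarz. This e minimizes
  -- the dual norm of the coefficients 1 − e(σ − λ_i)/σ once the favourable h term is dropped; the
  -- minimum is D/(3N).
  obtain ⟨e, he⟩ : ∃ e : ℝ, e = (2 * s + n - 1) / N := ⟨_, rfl⟩
  have he0 : 0 ≤ e := by rw [he]; apply div_nonneg <;> linarith
  have he3 : e ≤ 3 := by
    rw [he, div_le_iff₀ hN0, hN]
    nlinarith [sq_nonneg (s - 1)]
  have heN : e * N = 2 * s + n - 1 := by rw [he]; field_simp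
  obtain ⟨D, hD⟩ : ∃ D : ℝ, D = 2 * n * s ^ 2 - 4 * (n - 1) * s + 3 * (n - 1) := ⟨_, rfl⟩
  obtain ⟨Y, hY⟩ : ∃ Y : ℝ, Y = 3 * ∑ i, y i ^ 2 - 2 * y k ^ 2 := ⟨_, rfl⟩
  have hsum : ∑ i, (1 - e / σ * (σ - lam i)) * y i = t - e / σ * q := by
    rw [ht, hq, Finset.mul_sum, ← Finset.sum_sub_distrib]
    exact Finset.sum_congr rfl fun i _ => by ring
  have hcs : (t - e / σ * q) ^ 2 ≤
      (∑ i, (1 - e / σ * (σ - lam i)) ^ 2 * (if i = k then 1 else 1 / 3)) *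
        ∑ i, y i ^ 2 * (if i = k then 1 else 3) := by
    rw [← hsum]
    apply Finset.sum_sq_le_sum_mul_sum_of_sq_le_mul
    · intro i _; split_ifs <;> positivity
    · intro i _; split_ifs <;> positivity
    · intro i _; split_ifs <;> exact le_of_eq (by ring)
  have hYe : ∑ i, y i ^ 2 * (if i = k then (1 : ℝ) else 3) = Y := by
    have : ∀ i, y i ^ 2 * (if i = k then (1 : ℝ) else 3) =
        3 * y i ^ 2 - (if i = k then 2 * y i ^ 2 else 0) := fun i => by split_ifs <;> ring
    simp_rw [this]
    rw [Finset.sum_sub_distrib, ← Finset.mul_sum, hY]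
    simp
  have hRe : ∑ i, (1 - e / σ * (σ - lam i)) ^ 2 * (if i = k then (1 : ℝ) else 1 / 3) =
      (n - 2 * e * (n - 1) + e ^ 2 * (n - 1) - 2 * h * (e / σ) ^ 2) / 3 +
        2 / 3 * (1 - e * s) ^ 2 := by
    have : ∀ i, (1 - e / σ * (σ - lam i)) ^ 2 * (if i = k then (1 : ℝ) else 1 / 3) =
        1 / 3 * (1 - 2 * (e / σ) * (σ - lam i) + (e / σ) ^ 2 * (σ - lam i) ^ 2) +
          (if i = k then 2 / 3 * (1 - e / σ * (σ - lam i)) ^ 2 else 0) := fun i => by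
      split_ifs <;> ring
    simp_rw [this]
    rw [Finset.sum_add_distrib, ← Finset.mul_sum, Finset.sum_add_distrib, Finset.sum_sub_distrib,
      ← Finset.mul_sum, ← Finset.mul_sum, sum_linearized hσ, sum_linearized_sq hσ hh, hs]
    simp
    field_simp
    ring
  have hR : ∑ i, (1 - e / σ * (σ - lam i)) ^ 2 * (if i = k then (1 : ℝ) else 1 / 3) ≤
      D / (3 * N) := by
    rw [hRe, le_div_iff₀ (by positivity)]
    have h1 : 0 ≤ 2 * h * (e / σ) ^ 2 := by positivity
    have h2 : (n - 2 * e * (n - 1) + e ^ 2 * (n - 1) + 2 * (1 - e * s) ^ 2) * N = D := by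
      have : (n - 2 * e * (n - 1) + e ^ 2 * (n - 1) + 2 * (1 - e * s) ^ 2) =
        n + 2 - 2 * e * (2 * s + n - 1) + e * (e * N) := by rw [hN]; ring
      rw [this, heN]
      have : (n + 2 - 2 * e * (2 * s + n - 1) + e * (2 * s + n - 1)) * N =
        (n + 2) * N - (e * N) * (2 * s + n - 1) := by ring
      rw [this, heN, hN, hD]
      ring
    have h3 := mul_nonneg h1 hN0.le
    have h4 : ((n - 2 * e * (n - 1) + e ^ 2 * (n - 1) - 2 * h * (e / σ) ^ 2) / 3 +
        2 / 3 * (1 - e * s) ^ 2) * (3 * N) =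
      (n - 2 * e * (n - 1) + e ^ 2 * (n - 1) + 2 * (1 - e * s) ^ 2) * N -
        2 * h * (e / σ) ^ 2 * N := by ring
    linarith
  have hY0 : 0 ≤ Y := by
    rw [← hYe]
    exact Finset.sum_nonneg fun i _ => by split_ifs <;> positivity
  have hcs' : (t - e / σ * q) ^ 2 ≤ D / (3 * N) * Y := by
    rw [hYe] at hcs
    exact hcs.trans (mul_le_mul_of_nonneg_right hR hY0)
  obtain ⟨ε, hε⟩ : ∃ ε : ℝ, ε = (1 + c - s) / 22 := ⟨_, rfl⟩
  have hε0 : 0 ≤ ε := by rw [hε]; linarith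
  have hε1 : ε ≤ 1 := by rw [hε]; linarith
  have hDε : D * (1 + ε) ≤ 4 * (n - 1) - 2 * (n - 3) * s := by
    rw [hD, hε]
    exact ratio_bound hn' hc hc1 hc2 hs0 hsc
  -- A is the coefficient of t² being aimed at: 1 cancels the −t² in the conclusion, s alone gives
  -- the Jacobi term, and sε is the gain.
  obtain ⟨A, hA⟩ : ∃ A : ℝ, A = 1 + s * (1 + ε) := ⟨_, rfl⟩
  have hA0 : 0 < A := by rw [hA]; positivity
  have hA5 : A ≤ 5 := by rw [hA]; nlinarith
  have hDA : D * A ≤ 3 * N := by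
    have : 3 * N - D = s * (4 * (n - 1) - 2 * (n - 3) * s) := by rw [hN, hD]; ring
    have h8 := mul_le_mul_of_nonneg_left hDε hs0.le
    have h9 : D * A = D + s * (D * (1 + ε)) := by rw [hA]; ring
    linarith
  have hmain : A * (t - e / σ * q) ^ 2 ≤ Y := by
    calc A * (t - e / σ * q) ^ 2 ≤ A * (D / (3 * N) * Y) := by gcongr
      _ = (D * A) / (3 * N) * Y := by ring
      _ ≤ 1 * Y := by
        gcongr
        rw [div_le_one (by positivity)]
        exact hDA
      _ = Y := one_mul _
  have hd : A * (t * (e / σ * q)) ≤ 15 * |t| * |q| / σ := by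
    have h1 : t * q ≤ |t| * |q| := by rw [← abs_mul]; exact le_abs_self _
    have h2 : A * e ≤ 15 := (mul_le_mul hA5 he3 he0 (by norm_num)).trans (by norm_num)
    calc A * (t * (e / σ * q)) = (A * e) * (t * q) / σ := by ring
      _ ≤ (A * e) * (|t| * |q|) / σ := by gcongr
      _ ≤ 15 * (|t| * |q|) / σ := by gcongr
      _ = _ := by ring
  rw [← hY, ← hs, hlk, show c + (1 - s) = 1 + c - s by ring, ← hε]
  have hex : A * (t - e / σ * q) ^ 2 =
    A * t ^ 2 - 2 * (A * (t * (e / σ * q))) + A * (e / σ * q) ^ 2 := by ring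
  have h5 : 0 ≤ A * (e / σ * q) ^ 2 := by positivity
  have h6 : A * t ^ 2 = t ^ 2 + s * (1 + ε) * t ^ 2 := by rw [hA]; ring
  have h7 : 30 * |t| * |q| / σ = 2 * (15 * |t| * |q| / σ) := by ring
  linarith

end TwoConvex

/-! ### The upper bound at a critical point -/

lemma young_drift {F G L σ : ℝ} (hF : 0 < F) (hL : 0 < L) (h : 1 ≤ F * (L * σ)) :
    92 * L * G ≤ F * G ^ 2 + 2116 * L ^ 3 * σ := by
  have h8 : 92 * L * (F * G) ≤ (F * G) ^ 2 + 2116 * L ^ 2 := by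
    nlinarith [sq_nonneg (F * G - 46 * L)]
  have h9 : F * (92 * L * G) ≤ F * (F * G ^ 2 + 2116 * L ^ 3 * σ) := by
    have h10 : 2116 * L ^ 2 * 1 ≤ 2116 * L ^ 2 * (F * (L * σ)) := by gcongr
    linarith
  exact le_of_mul_le_mul_left h9 hF

/-- The dangerous term (αx + βu)λa is linear in the Hessian. The first-order condition replaces it
by (4x/ρ − g)a, which leaves only a 1/ρ term and a drift |g|. -/
lemma drift_ge {L Γ ρ α β x u Ax Az a lam g : ℝ} (hL : 1 ≤ L) (hΓ : 1 ≤ Γ) (hρ : 0 < ρ)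
    (hα : 0 ≤ α) (hβ : 0 ≤ β) (hαΓ : α * Γ ≤ 2) (hβΓ : β * Γ ^ 2 ≤ 1) (hx : |x| ≤ 3)
    (hu : |u| ≤ Γ) (hAx : |Ax| ≤ L) (ha : |a| ≤ L) (hAz : |Az| ≤ L)
    (hfirst : g = 4 * x / ρ - (α * x + β * u) * lam) :
    -(6 * L * 2 + 2 * L) - 12 * L / ρ - L * |g| ≤
      α * (x * (Ax + Az * u + lam * a)) + β * (u * (Ax + Az * u + lam * a)) := by
  have hL0 : 0 < L := by linarith
  have e1 : α * (x * (Ax + Az * u + lam * a)) + β * (u * (Ax + Az * u + lam * a)) =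
      α * (x * (Ax + Az * u)) + β * (u * (Ax + Az * u)) + (4 * x / ρ * a - g * a) := by
    rw [hfirst]; ring
  have h2 : |Ax + Az * u| ≤ 2 * L * Γ := by
    refine (abs_add_le _ _).trans ?_
    have h3 : |Az * u| ≤ L * Γ := by
      rw [abs_mul]; exact mul_le_mul hAz hu (abs_nonneg _) hL0.le
    have h4 : L * 1 ≤ L * Γ := by gcongr
    linarith
  have h3 : |x * (Ax + Az * u)| ≤ 3 * (2 * L * Γ) := by
    rw [abs_mul]; exact mul_le_mul hx h2 (abs_nonneg _) (by norm_num)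
  have h4 : |u * (Ax + Az * u)| ≤ Γ * (2 * L * Γ) := by
    rw [abs_mul]; exact mul_le_mul hu h2 (abs_nonneg _) (by linarith)
  have h5 : |4 * x / ρ * a| ≤ 12 / ρ * L := by
    rw [abs_mul]
    refine mul_le_mul ?_ ha (abs_nonneg _) (by positivity)
    rw [abs_div, abs_of_pos hρ, abs_mul]
    gcongr
    rw [abs_of_pos (by norm_num : (0 : ℝ) < 4)]
    linarith
  have h6 : |g * a| ≤ |g| * L := by rw [abs_mul]; gcongr
  have h7 := mul_le_mul_of_nonneg_left (neg_le_of_abs_le h3) hα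
  have h8 := mul_le_mul_of_nonneg_left (neg_le_of_abs_le h4) hβ
  have h9 : α * Γ * (6 * L) ≤ 2 * (6 * L) := by gcongr
  have h10 : β * Γ ^ 2 * (2 * L) ≤ 1 * (2 * L) := by gcongr
  rw [e1]
  have h11 := neg_le_of_abs_le h5
  have h12 := le_of_abs_le h6
  have h13 : 12 / ρ * L = 12 * L / ρ := by ring
  linarith

section CriticalPoint

variable {n : ℕ} {lam : Fin n → ℝ} {σ h : ℝ}

lemma one_le_linearized_mul {L : ℝ} (hσ0 : 0 < σ) (hh : 2 * h = σ ^ 2 - ∑ i, lam i ^ 2)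
    (hh0 : 0 < h) (hL : 0 < L) (h0 : 1 ≤ L * h) (k : Fin n) : 1 ≤ (σ - lam k) * (L * σ) := by
  have h3 := div_le_linearized hσ0 hh hh0 k
  rw [div_le_iff₀ hσ0] at h3
  have h4 := mul_le_mul_of_nonneg_left h3 hL.le
  linarith

/-- The almost Jacobi inequality for `log Δu`, in terms of the normalized gradient
`g k = Δu_k / (σ b)`. -/
lemma almost_jacobi (hn : 4 ≤ n) (hσ : σ = ∑ i, lam i) (hσ1 : 1 ≤ σ)
    (hh : 2 * h = σ ^ 2 - ∑ i, lam i ^ 2) (h0 : 0 < h)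
    (hk : ∀ k, -dynConst n * σ ≤ lam k) {T : Fin n → Fin n → Fin n → ℝ}
    (hT₁ : ∀ i j k, T i j k = T j i k) (hT₂ : ∀ i j k, T i j k = T i k j)
    {u Ax a τ g : Fin n → ℝ} {Az L Γ b : ℝ} (hL : 1 ≤ L) (hΓσ : Γ ≤ σ) (hb : 1 ≤ b)
    (hu : ∀ k, |u k| ≤ Γ) (hAx : ∀ k, |Ax k| ≤ L) (ha : ∀ k, |a k| ≤ L) (hAz : |Az| ≤ L)
    (hgrad : ∀ k, ∑ i, (σ - lam i) * T i i k = Ax k + Az * u k + lam k * a k)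
    (hg : ∀ k, ∑ i, T i i k = σ * b * g k)
    (hlap : Az * σ + ∑ k, (∑ i, T i i k) * a k - L * ∑ k, (1 + |u k| + |lam k|) ^ 2 ≤
      ∑ k, (∑ i, T i i k) ^ 2 - ∑ k, ∑ i, ∑ j, T i j k ^ 2 + ∑ k, (σ - lam k) * τ k) :
    ∑ k, (σ - lam k) * (1 + (dynConst n + lam k / σ) / 22) * b * g k ^ 2 - 91 * L * ∑ k, |g k| -
      10 * n * L * σ / b ≤ (∑ k, (σ - lam k) * τ k) / (σ * b) := by
  have hσ0 : 0 < σ := by linarith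
  have hb0 : 0 < b := by linarith
  have hL0 : 0 < L := by linarith
  have hn' : (4 : ℝ) ≤ n := by exact_mod_cast hn
  have hlam := fun k => abs_le_sum hσ0 hh h0 k
  -- By the once differentiated equation this sum is a derivative of the right-hand side, hence only
  -- linear in σ. With the factor 30 of `third_order_ge` it produces the 90 below.
  have hq : ∀ k, |∑ i, (σ - lam i) * T i i k| ≤ 3 * L * σ := by
    intro k
    rw [hgrad]
    have h1 : |Az * u k| ≤ L * σ := by
      rw [abs_mul]; exact mul_le_mul hAz ((hu k).trans hΓσ) (abs_nonneg _) hL0.le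
    have h2 : |lam k * a k| ≤ σ * L := by
      rw [abs_mul]; exact mul_le_mul (hlam k) (ha k) (abs_nonneg _) hσ0.le
    have h3 := abs_add_three (Ax k) (Az * u k) (lam k * a k)
    have h4 : L * 1 ≤ L * σ := by gcongr
    linarith [hAx k]
  have hQ : ∀ k, σ * b * ((σ - lam k) * (1 + (dynConst n + lam k / σ) / 22) * b * g k ^ 2 -
      90 * L * |g k|) ≤
      3 * ∑ i, T i i k ^ 2 - 2 * T k k k ^ 2 - (∑ i, T i i k) ^ 2 := by
    intro k
    refine le_trans ?_ (third_order_ge hn hσ hσ0 hh h0 k (hk k) (y := fun i => T i i k) rfl rfl)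
    rw [hg, abs_mul, abs_of_pos (show 0 < σ * b by positivity)]
    have h1 : 30 * (σ * b * |g k|) * |∑ i, (σ - lam i) * T i i k| / σ ≤
        30 * (σ * b * |g k|) * (3 * L * σ) / σ := by
      gcongr
      exact hq k
    have h2 : 30 * (σ * b * |g k|) * (3 * L * σ) / σ = σ * b * (90 * L * |g k|) := by
      field_simp; ring
    have h3 : (σ - lam k) / σ * (1 + (dynConst n + lam k / σ) / 22) * (σ * b * g k) ^ 2 =
        σ * b * ((σ - lam k) * (1 + (dynConst n + lam k / σ) / 22) * b * g k ^ 2) := by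
      field_simp
    rw [h3]
    linarith
  have hsumQ := (Finset.sum_le_sum fun k (_ : k ∈ Finset.univ) => hQ k)
  rw [← Finset.mul_sum, Finset.sum_sub_distrib, Finset.sum_sub_distrib, ← Finset.mul_sum] at hsumQ
  have hT := sum_sq_symm_ge hT₁ hT₂
  have hta : -(σ * b * (L * ∑ k, |g k|)) ≤ ∑ k, (∑ i, T i i k) * a k := by
    rw [Finset.mul_sum, Finset.mul_sum, ← Finset.sum_neg_distrib]
    refine Finset.sum_le_sum fun k _ => ?_
    rw [hg]
    have h1 : |g k * a k| ≤ |g k| * L := by rw [abs_mul]; gcongr; exact ha k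
    have h2 := neg_le_of_abs_le h1
    have h3 := mul_le_mul_of_nonneg_left h2 (show 0 ≤ σ * b by positivity)
    linarith
  have hbd : L * ∑ k, (1 + |u k| + |lam k|) ^ 2 ≤ L * (n * (9 * σ ^ 2)) := by
    gcongr
    have : ∑ k : Fin n, (1 + |u k| + |lam k|) ^ 2 ≤ ∑ _k : Fin n, 9 * σ ^ 2 := by
      refine Finset.sum_le_sum fun k _ => ?_
      have h1 : 1 + |u k| + |lam k| ≤ 3 * σ := by linarith [hu k, hlam k]
      have h2 : 0 ≤ 1 + |u k| + |lam k| := by positivity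
      nlinarith
    simpa using this
  have hAzσ : -(L * σ ^ 2) ≤ Az * σ := by
    have h1 := mul_le_mul_of_nonneg_right (neg_le_of_abs_le hAz) hσ0.le
    have h2 : L * σ * 1 ≤ L * σ * σ := by gcongr
    linarith
  have hnl : L * σ ^ 2 ≤ n * L * σ ^ 2 := by
    have : 0 ≤ L * σ ^ 2 := by positivity
    nlinarith
  rw [le_div_iff₀ (by positivity)]
  have hexp : (10 * n * L * σ / b) * (σ * b) = 10 * n * L * σ ^ 2 := by field_simp
  rw [sub_mul, hexp]
  linarith

set_option maxHeartbeats 800000 in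
/-- The maximum principle at a critical point of the test function
`2 log ρ + α (x·Du - u) + β |Du|² / 2 + log b`. -/
lemma critical_point_ineq (hn : 4 ≤ n) (hσ : σ = ∑ i, lam i) (hσ1 : 1 ≤ σ)
    (hh : 2 * h = σ ^ 2 - ∑ i, lam i ^ 2)
    (hk : ∀ k, -dynConst n * σ ≤ lam k) {T : Fin n → Fin n → Fin n → ℝ}
    (hT₁ : ∀ i j k, T i j k = T j i k) (hT₂ : ∀ i j k, T i j k = T i k j)
    {x u Ax a τ g : Fin n → ℝ} {Az L Γ b ρ α β : ℝ} (hL : 1 ≤ L) (h0 : 1 ≤ L * h) (hΓ : 1 ≤ Γ)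
    (hΓσ : Γ ≤ σ) (hb : 1 ≤ b) (hρ : 0 < ρ) (hρ9 : ρ ≤ 9) (hρb : ρ ^ 2 ≤ 81 * b)
    (hα : 0 ≤ α) (hβ : 0 ≤ β) (hαΓ : α * Γ ≤ 2) (hβΓ : β * Γ ^ 2 ≤ 1)
    (hx : ∀ k, |x k| ≤ 3)
    (hu : ∀ k, |u k| ≤ Γ) (hAx : ∀ k, |Ax k| ≤ L) (ha : ∀ k, |a k| ≤ L) (hAz : |Az| ≤ L)
    (hgrad : ∀ k, ∑ i, (σ - lam i) * T i i k = Ax k + Az * u k + lam k * a k)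
    (hg : ∀ k, ∑ i, T i i k = σ * b * g k)
    (hlap : Az * σ + ∑ k, (∑ i, T i i k) * a k - L * ∑ k, (1 + |u k| + |lam k|) ^ 2 ≤
      ∑ k, (∑ i, T i i k) ^ 2 - ∑ k, ∑ i, ∑ j, T i j k ^ 2 + ∑ k, (σ - lam k) * τ k)
    (hfirst : ∀ k, g k = 4 * x k / ρ - (α * x k + β * u k) * lam k)
    (hsecond : ∀ k, -4 / ρ - 8 * x k ^ 2 / ρ ^ 2 +
      (α * (lam k + ∑ j, x j * T k k j) + β * (lam k ^ 2 + ∑ j, u j * T k k j)) +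
      τ k / (σ * b) - b * g k ^ 2 - g k ^ 2 ≤ 0) :
    β * ∑ k, (σ - lam k) * lam k ^ 2 +
      ∑ k, ((dynConst n + lam k / σ) / 22 * b - 2) * ((σ - lam k) * g k ^ 2) ≤
      200000 * n * L ^ 3 * σ / ρ ^ 2 := by
  have hσ0 : 0 < σ := by linarith
  have hb0 : 0 < b := by linarith
  have hL0 : 0 < L := by linarith
  have hn' : (4 : ℝ) ≤ n := by exact_mod_cast hn
  have hh0 : 0 < h := by
    by_contra! hcon
    nlinarith
  have hlam := fun k => abs_le_sum hσ0 hh hh0 k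
  have hf : ∀ k, 0 < σ - lam k := fun k =>
    lt_of_lt_of_le (by positivity) (div_le_linearized hσ0 hh hh0 k)
  have hjac := almost_jacobi hn hσ hσ1 hh hh0 hk hT₁ hT₂ hL hΓσ hb hu hAx ha hAz hgrad hg hlap
  -- Contract the second-order condition with the positive linearized operator.
  have hsum := Finset.sum_nonpos fun k (_ : k ∈ Finset.univ) =>
    mul_nonpos_of_nonneg_of_nonpos (hf k).le (hsecond k)
  have hexp : ∀ k, (σ - lam k) * (-4 / ρ - 8 * x k ^ 2 / ρ ^ 2 +
      (α * (lam k + ∑ j, x j * T k k j) + β * (lam k ^ 2 + ∑ j, u j * T k k j)) +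
      τ k / (σ * b) - b * g k ^ 2 - g k ^ 2) =
      -((σ - lam k) * (4 / ρ + 8 * x k ^ 2 / ρ ^ 2)) + α * ((σ - lam k) * lam k) +
      α * ∑ j, x j * ((σ - lam k) * T k k j) + β * ((σ - lam k) * lam k ^ 2) +
      β * (∑ j, u j * ((σ - lam k) * T k k j)) + (σ - lam k) * τ k / (σ * b) -
      (σ - lam k) * (b + 1) * g k ^ 2 := by
    intro k
    have e1 : ∀ z : Fin n → ℝ, ∑ j, z j * ((σ - lam k) * T k k j) =
        (σ - lam k) * ∑ j, z j * T k k j := by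
      intro z
      rw [Finset.mul_sum]
      exact Finset.sum_congr rfl fun j _ => by ring
    rw [e1, e1]
    ring
  simp_rw [hexp] at hsum
  rw [Finset.sum_sub_distrib, Finset.sum_add_distrib, Finset.sum_add_distrib,
    Finset.sum_add_distrib, Finset.sum_add_distrib, Finset.sum_add_distrib,
    Finset.sum_neg_distrib, ← Finset.mul_sum, ← Finset.mul_sum, ← Finset.mul_sum,
    ← Finset.mul_sum, ← Finset.sum_div] at hsum
  have hswap : ∀ z : Fin n → ℝ, ∑ k, ∑ j, z j * ((σ - lam k) * T k k j) =
      ∑ j, z j * (Ax j + Az * u j + lam j * a j) := by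
    intro z
    rw [Finset.sum_comm]
    refine Finset.sum_congr rfl fun j _ => ?_
    rw [← Finset.mul_sum, hgrad]
  rw [hswap, hswap] at hsum
  have hfl : ∑ k, (σ - lam k) * lam k = 2 * h := by
    simp_rw [sub_mul]
    rw [Finset.sum_sub_distrib, ← Finset.mul_sum, ← hσ, hh]
    simp [pow_two]
  rw [hfl] at hsum
  -- the zeroth-order terms
  have hrho : ∑ k, (σ - lam k) * (4 / ρ + 8 * x k ^ 2 / ρ ^ 2) ≤ 108 * n * (σ / ρ ^ 2) := by
    have h1 : ∀ k, (σ - lam k) * (4 / ρ + 8 * x k ^ 2 / ρ ^ 2) ≤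
        (σ - lam k) * (108 / ρ ^ 2) := by
      intro k
      refine mul_le_mul_of_nonneg_left ?_ (hf k).le
      have h2 : x k ^ 2 ≤ 9 := by
        have := abs_le.1 (hx k); nlinarith
      have h3 : 4 / ρ = 4 * ρ / ρ ^ 2 := by field_simp
      rw [h3, ← add_div]
      gcongr
      linarith
    refine (Finset.sum_le_sum fun k _ => h1 k).trans ?_
    rw [← Finset.sum_mul, sum_linearized hσ]
    have : 0 ≤ σ * (108 / ρ ^ 2) := by positivity
    calc (n - 1) * σ * (108 / ρ ^ 2) = 108 * n * (σ / ρ ^ 2) - σ * (108 / ρ ^ 2) := by ring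
      _ ≤ _ := by linarith
  -- the first-order terms
  have hterm : ∀ k, -(6 * L * 2 + 2 * L) - 12 * L / ρ - L * |g k| ≤
      α * (x k * (Ax k + Az * u k + lam k * a k)) +
        β * (u k * (Ax k + Az * u k + lam k * a k)) := by
    intro k
    exact drift_ge hL hΓ hρ hα hβ hαΓ hβΓ (hx k) (hu k) (hAx k) (ha k) hAz (hfirst k)
  have hterms := Finset.sum_le_sum fun k (_ : k ∈ Finset.univ) => hterm k
  rw [Finset.sum_add_distrib, ← Finset.mul_sum, ← Finset.mul_sum, Finset.sum_sub_distrib,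
    ← Finset.mul_sum] at hterms
  simp only [Finset.sum_const, Finset.card_univ, Fintype.card_fin, nsmul_eq_mul] at hterms
  -- Young's inequality for the drift
  have hyoung : 92 * L * ∑ k, |g k| ≤ ∑ k, (σ - lam k) * g k ^ 2 + n * (2116 * L ^ 3 * σ) := by
    have h1 : ∀ k, 92 * L * |g k| ≤ (σ - lam k) * g k ^ 2 + 2116 * L ^ 3 * σ := by
      intro k
      rw [← sq_abs (g k)]
      exact young_drift (hf k) hL0 (one_le_linearized_mul hσ0 hh hh0 hL0 h0 k)
    rw [Finset.mul_sum]
    refine (Finset.sum_le_sum fun k _ => h1 k).trans ?_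
    rw [Finset.sum_add_distrib]
    simp
  -- collect
  have hJ : ∑ k, (σ - lam k) * (1 + (dynConst n + lam k / σ) / 22) * b * g k ^ 2 =
      ∑ k, ((dynConst n + lam k / σ) / 22 * b - 2) * ((σ - lam k) * g k ^ 2) +
        ∑ k, (σ - lam k) * (b + 1) * g k ^ 2 + ∑ k, (σ - lam k) * g k ^ 2 := by
    rw [← Finset.sum_add_distrib, ← Finset.sum_add_distrib]
    exact Finset.sum_congr rfl fun k _ => by ring
  -- Every error is measured against n L³ R, using ρ ≤ 9 and ρ² ≤ 81b; the coefficients add up to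
  -- less than 200000.
  obtain ⟨R, hR⟩ : ∃ R, R = σ / ρ ^ 2 := ⟨_, rfl⟩
  have hR0 : 0 < R := by rw [hR]; positivity
  have hσR : σ ≤ 81 * R := by
    have h1 : ρ ^ 2 ≤ 81 := by nlinarith
    rw [hR, mul_div_assoc', le_div_iff₀ (by positivity)]
    nlinarith
  have hσb : σ / b ≤ 81 * R := by
    rw [hR, div_le_iff₀ hb0, mul_div_assoc', div_mul_eq_mul_div, le_div_iff₀ (by positivity)]
    nlinarith
  have hρR : 1 / ρ ≤ 9 * R := by
    rw [hR, mul_div_assoc', div_le_div_iff₀ hρ (by positivity)]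
    nlinarith
  have hL3 : L ≤ L ^ 3 := le_self_pow₀ hL (by norm_num)
  have hLn : 0 < n * L := by positivity
  have b1 : n * (12 * L / ρ) ≤ n * L * (108 * R) := by
    have : n * (12 * L / ρ) = n * L * (12 * (1 / ρ)) := by ring
    rw [this]; refine mul_le_mul_of_nonneg_left ?_ hLn.le; linarith
  have b2 : 10 * n * L * σ / b ≤ n * L * (810 * R) := by
    have : 10 * n * L * σ / b = n * L * (10 * (σ / b)) := by ring
    rw [this]; refine mul_le_mul_of_nonneg_left ?_ hLn.le; linarith
  have b3 : n * (6 * L * 2 + 2 * L) ≤ n * L * (14 * 81 * R) := by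
    have : n * (6 * L * 2 + 2 * L) = n * L * 14 := by ring
    rw [this]; refine mul_le_mul_of_nonneg_left ?_ hLn.le; linarith
  have b4 : n * (2116 * L ^ 3 * σ) ≤ n * L ^ 3 * (2116 * 81 * R) := by
    have : n * (2116 * L ^ 3 * σ) = n * L ^ 3 * (2116 * σ) := by ring
    rw [this]; refine mul_le_mul_of_nonneg_left ?_ (by positivity); linarith
  have b5 : n * L * R ≤ n * L ^ 3 * R := by gcongr
  have b6 : n * R ≤ n * L * R := by
    have : n * R * 1 ≤ n * R * L := by gcongr
    linarith
  have b7 : 0 ≤ α * (2 * h) := by positivity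
  have b8 : 0 ≤ n * L ^ 3 * R := by positivity
  have b9 : 200000 * n * L ^ 3 * σ / ρ ^ 2 = 200000 * (n * L ^ 3 * R) := by rw [hR]; ring
  rw [b9]
  rw [← hR] at hrho
  rw [hJ] at hjac
  linarith

end CriticalPoint

/-! ### The lower bound at a critical point, by direction -/

lemma slope_sq_le {n Γ α β η x u : ℝ} (hn : 1 ≤ n) (hΓ : 1 ≤ Γ) (hβ0 : 0 < β)
    (hβ : β * Γ ^ 2 = η) (hα : α = 2 * n * β * Γ) (hx : |x| ≤ 3) (hu : |u| ≤ Γ) :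
    (α * x + β * u) ^ 2 ≤ 49 * n ^ 2 * η * β := by
  have h1 : |α * x + β * u| ≤ 7 * n * β * Γ := by
    refine (abs_add_le _ _).trans ?_
    have hα0 : 0 ≤ α := by rw [hα]; positivity
    have h2 : |α * x| ≤ α * 3 := by rw [abs_mul, abs_of_nonneg hα0]; gcongr
    have h3 : |β * u| ≤ β * Γ := by rw [abs_mul, abs_of_pos hβ0]; gcongr
    have h4 : β * Γ * 1 ≤ β * Γ * n := by gcongr
    rw [hα] at h2
    rw [hα]
    linarith
  calc (α * x + β * u) ^ 2 ≤ (7 * n * β * Γ) ^ 2 := sq_le_sq' (abs_le.1 h1).1 (abs_le.1 h1).2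
    _ = 49 * n ^ 2 * η * β := by rw [← hβ]; ring

/-- The estimate when `x` is not aligned with the top eigenvector. -/
lemma transversal_direction {n σ f lam x w g b ρ β C η : ℝ} (hn : 1 ≤ n) (hσ : 0 < σ)
    (hf : σ / 4 ≤ f) (hρ : 0 < ρ) (hβ : 0 < β) (hC : 0 < C) (hη : η * (100000 * n ^ 3 * C) = 1)
    (hb : 1000 * n * C ≤ b) (hx : 1 ≤ n * x ^ 2)
    (hw : w ^ 2 ≤ 49 * n ^ 2 * η * β) (hg : g = 4 * x / ρ - w * lam) :
    C * σ / ρ ^ 2 < β * (f * lam ^ 2) + b / 352 * (f * g ^ 2) := by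
  have hb0 : 0 < b := lt_of_lt_of_le (by positivity) hb
  have hf0 : 0 < f := lt_of_lt_of_le (by positivity) hf
  -- Since 4x/ρ = g + wλ, either g or wλ is large. The first is paid for by b g², the second by βλ²
  -- because w² is a small multiple of β.
  have h1 : 16 * x ^ 2 / ρ ^ 2 ≤ 2 * g ^ 2 + 2 * (w ^ 2 * lam ^ 2) := by
    have : 16 * x ^ 2 / ρ ^ 2 = (g + w * lam) ^ 2 := by rw [hg]; ring
    rw [this]
    nlinarith [sq_nonneg (g - w * lam)]
  have h2 : 16 / ρ ^ 2 ≤ n * (2 * g ^ 2 + 2 * (w ^ 2 * lam ^ 2)) := by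
    calc 16 / ρ ^ 2 ≤ 16 * (n * x ^ 2) / ρ ^ 2 := by gcongr; linarith
      _ = n * (16 * x ^ 2 / ρ ^ 2) := by ring
      _ ≤ _ := by gcongr
  have h3 : n * (2 * (w ^ 2 * lam ^ 2)) * (1000 * C) ≤ β * lam ^ 2 := by
    calc n * (2 * (w ^ 2 * lam ^ 2)) * (1000 * C) ≤
        n * (2 * (49 * n ^ 2 * η * β * lam ^ 2)) * (1000 * C) := by gcongr
      _ = 98 / 100 * (η * (100000 * n ^ 3 * C)) * (β * lam ^ 2) := by ring
      _ = 98 / 100 * (β * lam ^ 2) := by rw [hη]; ring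
      _ ≤ β * lam ^ 2 := by
        have : 0 ≤ β * lam ^ 2 := by positivity
        linarith
  have h4 : n * (2 * g ^ 2) * C ≤ b * g ^ 2 / 500 := by
    have : 1000 * n * C * g ^ 2 ≤ b * g ^ 2 := by gcongr
    linarith
  have h5 : 16 / ρ ^ 2 * C ≤ n * (2 * g ^ 2 + 2 * (w ^ 2 * lam ^ 2)) * C := by gcongr
  have h6 : 0 ≤ β * lam ^ 2 := by positivity
  have h7 : 0 ≤ b * g ^ 2 := by positivity
  have h8 : 0 < C / ρ ^ 2 := by positivity
  have h9 : 16 / ρ ^ 2 * C = 16 * (C / ρ ^ 2) := by ring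
  have h10 : 8 * (C / ρ ^ 2) ≤ β * lam ^ 2 + b / 352 * g ^ 2 := by
    linarith
  calc C * σ / ρ ^ 2 = C / ρ ^ 2 * σ := by ring
    _ < 8 * (C / ρ ^ 2) * (σ / 4) := by nlinarith
    _ ≤ (β * lam ^ 2 + b / 352 * g ^ 2) * f := by gcongr
    _ = _ := by ring

/-- The estimate when `x` has a component along the top eigenvector. -/
lemma top_direction {n σ f lam x u g b ρ α β C η L Γ K : ℝ} (hn : 1 ≤ n) (hσ : 1 ≤ σ)
    (hL : 1 ≤ L) (hf : 1 ≤ f * (L * σ)) (hlam : σ ≤ n * lam) (hρ : 0 < ρ)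
    (hβ0 : 0 < β) (hC : 1 ≤ C) (hη0 : 0 < η) (hu : |u| ≤ Γ) (hx3 : |x| ≤ 3)
    (hK : K * η ^ 2 = 1000000 * n ^ 2 * L * C) (hb : K * Γ ^ 2 ≤ b * ρ ^ 2)
    (hσb : b ≤ L * σ) (hβ : β * Γ ^ 2 = η) (hα : α = 2 * n * β * Γ) (hx : 1 ≤ n * x ^ 2)
    (hg : g = 4 * x / ρ - (α * x + β * u) * lam) :
    C * σ / ρ ^ 2 < b / 352 * (f * g ^ 2) := by
  obtain ⟨w, hw⟩ : ∃ w, w = α * x + β * u := ⟨_, rfl⟩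
  rw [← hw] at hg
  have hσ0 : 0 < σ := by linarith
  have hL0 : 0 < L := by linarith
  have hn0 : 0 < n := by linarith
  have hρ2 : 0 < ρ ^ 2 := by positivity
  have hbK : 1000000 * n ^ 2 * L * C ≤ b * β * η * ρ ^ 2 := by
    calc 1000000 * n ^ 2 * L * C = K * (β * Γ ^ 2) * η := by rw [hβ, ← hK]; ring
      _ = (K * Γ ^ 2) * (β * η) := by ring
      _ ≤ (b * ρ ^ 2) * (β * η) := by gcongr
      _ = _ := by ring
  have hb0 : 0 < b := by
    by_contra! hcon
    have h1 : b * (β * η * ρ ^ 2) ≤ 0 := mul_nonpos_of_nonpos_of_nonneg hcon (by positivity)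
    have h2 : 0 < 1000000 * n ^ 2 * L * C := by positivity
    linarith
  -- The factor 2n in α makes |αx| at least twice |βu| when n x² ≥ 1, so the slope cannot cancel.
  have hw2 : η * β ≤ w ^ 2 := by
    have h1 : (α * x) ^ 2 ≤ 2 * w ^ 2 + 2 * (β * u) ^ 2 := by
      have : α * x = w - β * u := by rw [hw]; ring
      rw [this]
      nlinarith [sq_nonneg (w + β * u)]
    have h2 : (β * u) ^ 2 ≤ β * η := by
      have : u ^ 2 ≤ Γ ^ 2 := sq_le_sq' (abs_le.1 hu).1 (abs_le.1 hu).2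
      calc (β * u) ^ 2 = β ^ 2 * u ^ 2 := by ring
        _ ≤ β ^ 2 * Γ ^ 2 := by gcongr
        _ = β * η := by rw [← hβ]; ring
    have h3 : (α * x) ^ 2 = 4 * n * (n * x ^ 2) * (β * η) := by rw [hα, ← hβ]; ring
    have h4 : 4 * 1 * 1 * (β * η) ≤ 4 * n * (n * x ^ 2) * (β * η) := by gcongr
    linarith
  have hx9 : x ^ 2 ≤ 9 := by
    have := abs_le.1 hx3; nlinarith
  have hβσ : 1000000 * n ^ 2 * C ≤ β * η * σ * ρ ^ 2 := by
    have h1 : b * (β * η * ρ ^ 2) ≤ (L * σ) * (β * η * ρ ^ 2) := by gcongr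
    have h2 : L * (1000000 * n ^ 2 * C) ≤ L * (β * η * σ * ρ ^ 2) := by linarith
    exact le_of_mul_le_mul_left h2 hL0
  -- As λ ≥ σ/n, the term wλ grows with σ, and `hβσ` makes σ large enough for it to dominate 4x/ρ.
  have hg2 : β * η * σ ^ 2 ≤ 4 * n ^ 2 * g ^ 2 := by
    have h1 : (w * lam) ^ 2 ≤ 2 * g ^ 2 + 288 / ρ ^ 2 := by
      have e : w * lam = 4 * x / ρ - g := by rw [hg]; ring
      have e2 : 2 * (4 * x / ρ) ^ 2 ≤ 288 / ρ ^ 2 := by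
        rw [div_pow, mul_div_assoc']
        gcongr
        nlinarith
      rw [e]
      nlinarith [sq_nonneg (4 * x / ρ + g)]
    have h2 : σ ^ 2 ≤ n ^ 2 * lam ^ 2 := by
      rw [← mul_pow]; exact pow_le_pow_left₀ hσ0.le hlam 2
    have h3 : η * β * σ ^ 2 ≤ n ^ 2 * (w * lam) ^ 2 := by
      calc η * β * σ ^ 2 ≤ w ^ 2 * (n ^ 2 * lam ^ 2) := by gcongr
        _ = _ := by ring
    have h4 : n ^ 2 * (w * lam) ^ 2 ≤ n ^ 2 * (2 * g ^ 2 + 288 / ρ ^ 2) := by gcongr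
    have h5 : 576 * n ^ 2 / ρ ^ 2 ≤ β * η * σ ^ 2 := by
      rw [div_le_iff₀ hρ2]
      have h6 : β * η * σ * ρ ^ 2 * 1 ≤ β * η * σ * ρ ^ 2 * σ := by gcongr
      have h7 : n ^ 2 * 1 ≤ n ^ 2 * C := by gcongr
      have h8 : 0 < n ^ 2 := by positivity
      linarith
    have h6 : n ^ 2 * (2 * g ^ 2 + 288 / ρ ^ 2) = 2 * n ^ 2 * g ^ 2 + 576 * n ^ 2 / ρ ^ 2 / 2 := by
      ring
    linarith
  have hfg : β * η * σ ≤ 4 * n ^ 2 * L * (f * g ^ 2) := by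
    have h1 : β * η * σ ^ 2 * 1 ≤ 4 * n ^ 2 * g ^ 2 * (f * (L * σ)) := by gcongr
    have h2 : σ * (β * η * σ) ≤ σ * (4 * n ^ 2 * L * (f * g ^ 2)) := by linarith
    exact le_of_mul_le_mul_left h2 hσ0
  rw [div_lt_iff₀ hρ2]
  have h1 : 1000000 * n ^ 2 * L * C * σ ≤ (b * ρ ^ 2) * (4 * n ^ 2 * L * (f * g ^ 2)) := by
    calc 1000000 * n ^ 2 * L * C * σ ≤ b * β * η * ρ ^ 2 * σ := by gcongr
      _ = (b * ρ ^ 2) * (β * η * σ) := by ring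
      _ ≤ _ := by gcongr
  have h2 : (n ^ 2 * L) * (250000 * (C * σ)) ≤ (n ^ 2 * L) * (b * (f * g ^ 2) * ρ ^ 2) := by
    linarith
  have h3 := le_of_mul_le_mul_left h2 (by positivity)
  have h4 : 0 < C * σ := by positivity
  linarith

section CriticalPoint

variable {n : ℕ} {lam : Fin n → ℝ} {σ h : ℝ}

/-- The estimate when the smallest eigenvalue is comparable to the trace. -/
lemma degenerate_direction {x u g : Fin n → ℝ} {Γ b ρ α β C η : ℝ} (hn : 4 ≤ n) (hσ1 : 1 ≤ σ)
    (hlam : ∀ k, |lam k| ≤ σ) (hf : ∀ k, 0 ≤ σ - lam k)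
    (hk : ∀ k, -dynConst n * σ ≤ lam k) {m : Fin n} (hm : lam m ≤ -(σ / 8)) (hΓ : 1 ≤ Γ)
    (hρ : 0 < ρ) (hb0 : 0 ≤ b) (hβ0 : 0 < β) (hC : 1152 * n ≤ C)
    (hη : 100000 * (n : ℝ) ^ 3 * η ≤ 1)
    (hβσ : 1000 * C ≤ β * σ * ρ ^ 2) (hβ : β * Γ ^ 2 = η) (hα : α = 2 * n * β * Γ)
    (hx : ∀ k, |x k| ≤ 3) (hu : ∀ k, |u k| ≤ Γ)
    (hfirst : ∀ k, g k = 4 * x k / ρ - (α * x k + β * u k) * lam k) :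
    C * σ / ρ ^ 2 < β * ∑ k, (σ - lam k) * lam k ^ 2 +
      ∑ k, ((dynConst n + lam k / σ) / 22 * b - 2) * ((σ - lam k) * g k ^ 2) := by
  have hn' : (4 : ℝ) ≤ n := by exact_mod_cast hn
  have hσ0 : 0 < σ := by linarith
  have hη0 : 0 < η := by rw [← hβ]; positivity
  have h1 : σ ^ 3 / 64 ≤ ∑ k, (σ - lam k) * lam k ^ 2 := by
    have h2 := Finset.single_le_sum (f := fun k => (σ - lam k) * lam k ^ 2)
      (fun i _ => mul_nonneg (hf i) (sq_nonneg _)) (Finset.mem_univ m)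
    refine le_trans ?_ h2
    have h3 : (σ / 8) ^ 2 ≤ lam m ^ 2 := by nlinarith
    calc σ ^ 3 / 64 = σ * (σ / 8) ^ 2 := by ring
      _ ≤ (σ - lam m) * lam m ^ 2 := by
        gcongr
        · exact hf m
        · linarith
  -- Here the gain is used only through its sign, so each coefficient may be as bad as −2. The
  -- resulting loss of order ηβσ³ is absorbed because η is small.
  have h2 : ∀ k, -(4 * σ * (288 / ρ ^ 2 + 98 * n ^ 2 * η * β * σ ^ 2)) ≤
      ((dynConst n + lam k / σ) / 22 * b - 2) * ((σ - lam k) * g k ^ 2) := by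
    intro k
    have h3 : 0 ≤ dynConst n + lam k / σ := by
      have : -dynConst n ≤ lam k / σ := by rw [le_div_iff₀ hσ0]; exact hk k
      linarith
    have h4 : g k ^ 2 ≤ 288 / ρ ^ 2 + 98 * n ^ 2 * η * β * σ ^ 2 := by
      have h5 := slope_sq_le (by linarith) hΓ hβ0 hβ hα (hx k) (hu k)
      have h6 : lam k ^ 2 ≤ σ ^ 2 := sq_le_sq' (abs_le.1 (hlam k)).1 (abs_le.1 (hlam k)).2
      have h7 : (α * x k + β * u k) ^ 2 * lam k ^ 2 ≤ 49 * n ^ 2 * η * β * σ ^ 2 := by gcongr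
      have h8 : x k ^ 2 ≤ 9 := by
        have := abs_le.1 (hx k); nlinarith
      have h9 : 2 * (4 * x k / ρ) ^ 2 ≤ 288 / ρ ^ 2 := by
        rw [div_pow, mul_div_assoc']
        gcongr
        nlinarith
      rw [hfirst]
      nlinarith [sq_nonneg (4 * x k / ρ + (α * x k + β * u k) * lam k)]
    have h5 : (σ - lam k) * g k ^ 2 ≤
        2 * σ * (288 / ρ ^ 2 + 98 * n ^ 2 * η * β * σ ^ 2) := by
      gcongr
      linarith [(abs_le.1 (hlam k)).1]
    have h6 : 0 ≤ (dynConst n + lam k / σ) / 22 * b * ((σ - lam k) * g k ^ 2) :=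
      mul_nonneg (mul_nonneg (by linarith) hb0) (mul_nonneg (hf k) (sq_nonneg _))
    linarith
  have h3 := Finset.sum_le_sum fun k (_ : k ∈ Finset.univ) => h2 k
  simp only [Finset.sum_const, Finset.card_univ, Fintype.card_fin, nsmul_eq_mul] at h3
  have h4 : β * (σ ^ 3 / 64) ≤ β * ∑ k, (σ - lam k) * lam k ^ 2 := by gcongr
  have h5 : n * -(4 * σ * (288 / ρ ^ 2 + 98 * n ^ 2 * η * β * σ ^ 2)) =
      -(1152 * n * (σ / ρ ^ 2)) - 392 / 100000 * (100000 * n ^ 3 * η) * (β * σ ^ 3) := by ring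
  have h6 : 100000 * n ^ 3 * η * (β * σ ^ 3) ≤ 1 * (β * σ ^ 3) := by gcongr
  have h7 : 1152 * n * (σ / ρ ^ 2) ≤ C * (σ / ρ ^ 2) := by gcongr
  have h8 : 1000 * (C * (σ / ρ ^ 2)) ≤ β * σ ^ 3 := by
    have e1 : 1000 * (C * (σ / ρ ^ 2)) = 1000 * C * σ / ρ ^ 2 := by ring
    rw [e1, div_le_iff₀ (by positivity)]
    calc 1000 * C * σ ≤ β * σ * ρ ^ 2 * σ := by gcongr
      _ = β * σ * ρ ^ 2 * σ * 1 := by ring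
      _ ≤ β * σ * ρ ^ 2 * σ * σ := by gcongr
      _ = _ := by ring
  have h9 : C * σ / ρ ^ 2 = C * (σ / ρ ^ 2) := by ring
  have h10 : 0 < β * σ ^ 3 := by positivity
  linarith

/-- At a critical point the test function cannot be large. -/
lemma critical_point_bound (hn : 4 ≤ n) (hσ : σ = ∑ i, lam i) (hσ1 : 1 ≤ σ)
    (hh : 2 * h = σ ^ 2 - ∑ i, lam i ^ 2)
    (hk : ∀ k, -dynConst n * σ ≤ lam k)
    {x u g : Fin n → ℝ} {L Γ b ρ α β C η K : ℝ} (hL : 1 ≤ L) (h0 : 1 ≤ L * h) (hΓ : 1 ≤ Γ)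
    (hρ : 0 < ρ) (hρ9 : ρ ≤ 9) (hb : K * Γ ^ 2 ≤ b * ρ ^ 2) (hσb : b ≤ L * σ)
    (hC : C = 200000 * n * L ^ 3) (hη : η * (100000 * n ^ 3 * C) = 1)
    (hK : K * η ^ 2 = 1000000 * n ^ 2 * L * C)
    (hβ : β * Γ ^ 2 = η) (hα : α = 2 * n * β * Γ)
    (hx : ∀ k, |x k| ≤ 3) (hx1 : 1 ≤ ∑ k, x k ^ 2) (hu : ∀ k, |u k| ≤ Γ)
    (hfirst : ∀ k, g k = 4 * x k / ρ - (α * x k + β * u k) * lam k) :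
    C * σ / ρ ^ 2 < β * ∑ k, (σ - lam k) * lam k ^ 2 +
      ∑ k, ((dynConst n + lam k / σ) / 22 * b - 2) * ((σ - lam k) * g k ^ 2) := by
  have hσ0 : 0 < σ := by linarith
  have hL0 : 0 < L := by linarith
  have hn' : (4 : ℝ) ≤ n := by exact_mod_cast hn
  have hn0 : (0 : ℝ) < n := by linarith
  have hh0 : 0 < h := by
    by_contra! hcon
    nlinarith
  have hlam := fun k => abs_le_sum hσ0 hh hh0 k
  have hf : ∀ k, 0 < σ - lam k := fun k =>
    lt_of_lt_of_le (by positivity) (div_le_linearized hσ0 hh hh0 k)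
  have hρ2 : 0 < ρ ^ 2 := by positivity
  have hCn : 200000 * n ≤ C := by
    have : (1 : ℝ) ≤ L ^ 3 := one_le_pow₀ hL
    rw [hC]
    nlinarith
  have hC1 : 1 ≤ C := by linarith
  have hC0 : 0 < C := by linarith
  have hη0 : 0 < η := by
    by_contra! hcon
    have : η * (100000 * n ^ 3 * C) ≤ 0 := mul_nonpos_of_nonpos_of_nonneg hcon (by positivity)
    linarith
  have hβ0 : 0 < β := by
    by_contra! hcon
    have : β * Γ ^ 2 ≤ 0 := mul_nonpos_of_nonpos_of_nonneg hcon (by positivity)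
    linarith
  have hη' : 100000 * (n : ℝ) ^ 3 * η ≤ 1 := by
    calc 100000 * (n : ℝ) ^ 3 * η = η * (100000 * n ^ 3 * 1) := by ring
      _ ≤ η * (100000 * n ^ 3 * C) := by gcongr
      _ = 1 := hη
  have hη1 : η ≤ 1 := by
    have : (1 : ℝ) ≤ n ^ 3 := one_le_pow₀ (by linarith)
    nlinarith
  have hK0 : 0 < K := by
    by_contra! hcon
    have h1 : K * η ^ 2 ≤ 0 := mul_nonpos_of_nonpos_of_nonneg hcon (by positivity)
    have : 0 < 1000000 * n ^ 2 * L * C := by positivity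
    linarith
  have hKη : 1000000 * n ^ 2 * L * C ≤ K * η := by
    rw [← hK]
    have : K * η * η ≤ K * η * 1 := by gcongr
    linarith
  have hKbig : 1000000 * n ^ 2 * C ≤ K := by
    have h1 : K * η ≤ K * 1 := by gcongr
    have h2 : 1000000 * n ^ 2 * C * 1 ≤ 1000000 * n ^ 2 * C * L := by gcongr
    linarith
  have hb' : K ≤ 81 * b := by
    have hb0 : 0 ≤ b := by
      by_contra! hcon
      have h1 : b * ρ ^ 2 ≤ 0 := mul_nonpos_of_nonpos_of_nonneg hcon.le hρ2.le
      have h2 : 0 < K * Γ ^ 2 := by positivity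
      linarith
    have h1 : K * 1 ≤ K * Γ ^ 2 := by gcongr; exact one_le_pow₀ hΓ
    have h2 : b * ρ ^ 2 ≤ b * 81 := by gcongr; nlinarith
    linarith
  have hbn : 1000 * n * C ≤ b := by
    have : (n : ℝ) * C * 1 ≤ n * C * n := by gcongr; linarith
    have h2 : 0 < n * C := by positivity
    linarith
  have hb0 : 0 < b := lt_of_lt_of_le (by positivity) hbn
  have hb704 : 704 ≤ b := by
    have : (1 : ℝ) * 1 ≤ n * C := by gcongr; linarith
    linarith
  by_cases hdeg : ∃ m, lam m ≤ -(σ / 8)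
  · obtain ⟨m, hm⟩ := hdeg
    refine degenerate_direction hn hσ1 hlam (fun k => (hf k).le) hk hm hΓ hρ hb0.le hβ0
      (by linarith) hη' ?_ hβ hα hx hu hfirst
    have h1 : L * (1000000 * n ^ 2 * C) ≤ L * (β * σ * ρ ^ 2) := by
      calc L * (1000000 * n ^ 2 * C) ≤ K * (β * Γ ^ 2) := by rw [hβ]; linarith
        _ = (K * Γ ^ 2) * β := by ring
        _ ≤ (b * ρ ^ 2) * β := by gcongr
        _ ≤ ((L * σ) * ρ ^ 2) * β := by gcongr
        _ = _ := by ring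
    have h2 := le_of_mul_le_mul_left h1 hL0
    have h3 : (1 : ℝ) ≤ n ^ 2 := one_le_pow₀ (by linarith)
    have h4 : 1 * C ≤ n ^ 2 * C := by gcongr
    linarith
  · push Not at hdeg
    have hc := le_dynConst hn
    -- With λ_k ≥ −σ/8 and c(n) > 1/4 the gain is at least 1/176; half of it pays for the −2 as soon
    -- as b ≥ 704.
    have hcoef : ∀ k, b / 352 * ((σ - lam k) * g k ^ 2) ≤
        ((dynConst n + lam k / σ) / 22 * b - 2) * ((σ - lam k) * g k ^ 2) := by
      intro k
      refine mul_le_mul_of_nonneg_right ?_ (mul_nonneg (hf k).le (sq_nonneg _))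
      have h1 : -(1 / 8) ≤ lam k / σ := by rw [le_div_iff₀ hσ0]; linarith [hdeg k]
      have h2 : 0 < 1 / (n : ℝ) := by positivity
      have h3 : (1 / 176) * b ≤ (dynConst n + lam k / σ) / 22 * b := by
        refine mul_le_mul_of_nonneg_right ?_ hb0.le
        linarith
      linarith
    have hsplit : ∀ k, β * ((σ - lam k) * lam k ^ 2) + b / 352 * ((σ - lam k) * g k ^ 2) ≤
        β * ∑ k, (σ - lam k) * lam k ^ 2 +
        ∑ k, ((dynConst n + lam k / σ) / 22 * b - 2) * ((σ - lam k) * g k ^ 2) := by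
      intro k
      refine add_le_add ?_ ?_
      · refine mul_le_mul_of_nonneg_left ?_ hβ0.le
        exact Finset.single_le_sum (f := fun k => (σ - lam k) * lam k ^ 2)
          (fun i _ => mul_nonneg (hf i).le (sq_nonneg _)) (Finset.mem_univ k)
      · refine (hcoef k).trans ?_
        refine Finset.single_le_sum
          (f := fun k => ((dynConst n + lam k / σ) / 22 * b - 2) * ((σ - lam k) * g k ^ 2))
          (fun i _ => le_trans ?_ (hcoef i)) (Finset.mem_univ k)
        exact mul_nonneg (by positivity) (mul_nonneg (hf i).le (sq_nonneg _))
    have : Nonempty (Fin n) := ⟨⟨0, by omega⟩⟩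
    obtain ⟨k, hxk⟩ : ∃ k, 1 ≤ n * x k ^ 2 := by
      by_contra! hcon
      have h1 : ∑ k, n * x k ^ 2 < ∑ _k : Fin n, (1 : ℝ) :=
        Finset.sum_lt_sum_of_nonempty Finset.univ_nonempty fun k _ => hcon k
      rw [← Finset.mul_sum] at h1
      simp at h1
      nlinarith
    obtain ⟨m, hm⟩ := Finite.exists_max lam
    refine lt_of_lt_of_le ?_ (hsplit k)
    by_cases hkm : k = m
    · subst hkm
      have h1 : 0 ≤ β * ((σ - lam k) * lam k ^ 2) :=
        mul_nonneg hβ0.le (mul_nonneg (hf k).le (sq_nonneg _))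
      have h2 := one_le_linearized_mul hσ0 hh hh0 hL0 h0 k
      have h4 : σ ≤ n * lam k := by
        rw [hσ]
        refine (Finset.sum_le_sum fun i _ => hm i).trans ?_
        simp
      have := top_direction (by linarith) hσ1 hL h2 h4 hρ hβ0 hC1 hη0 (hu k) (hx k) hK hb
        hσb hβ hα hxk (hfirst k)
      linarith
    · exact transversal_direction (by linarith) hσ0
        (quarter_le_linearized hσ0 hh hh0 hkm (hm k)) hρ hβ0 hC0 hη hbn hxk
        (slope_sq_le (by linarith) hΓ hβ0 hβ hα (hx k) (hu k)) (hfirst k)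

end CriticalPoint

open Filter Topology

/-! ### Directional derivatives -/

section Directional

variable {V W : Type*} [NormedAddCommGroup V] [NormedSpace ℝ V] [NormedAddCommGroup W]
  [NormedSpace ℝ W]

/-- The directional derivative of `g` in the direction `w`. -/
noncomputable def dirDeriv (w : V) (g : V → W) (x : V) : W := fderiv ℝ g x w

lemma contDiff_dirDeriv {g : V → W} (hg : ContDiff ℝ ∞ g) (w : V) :
    ContDiff ℝ ∞ (dirDeriv w g) :=
  (hg.fderiv_right (m := ∞) (by simp)).clm_apply contDiff_const

lemma differentiable_of_smooth {g : V → W} (hg : ContDiff ℝ ∞ g) : Differentiable ℝ g :=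
  hg.differentiable (by simp)

lemma dirDeriv_dirDeriv {g : V → W} (hg : ContDiff ℝ ∞ g) (a b x : V) :
    dirDeriv a (dirDeriv b g) x = fderiv ℝ (fderiv ℝ g) x a b := by
  have h := differentiable_of_smooth (hg.fderiv_right (m := ∞) (by simp))
  unfold dirDeriv
  rw [fderiv_clm_apply (h x) (differentiableAt_const b)]
  simp

lemma fderiv_fderiv_symm {g : V → W} (hg : ContDiff ℝ ∞ g) (x a b : V) :
    fderiv ℝ (fderiv ℝ g) x a b = fderiv ℝ (fderiv ℝ g) x b a := by
  refine hg.contDiffAt.isSymmSndFDerivAt ?_ a b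
  simp only [minSmoothness_of_isRCLikeNormedField]
  exact WithTop.coe_le_coe.2 (le_top : (2 : ℕ∞) ≤ ⊤)

lemma dirDeriv_comm {g : V → W} (hg : ContDiff ℝ ∞ g) (a b : V) :
    dirDeriv a (dirDeriv b g) = dirDeriv b (dirDeriv a g) := by
  ext x
  rw [dirDeriv_dirDeriv hg, dirDeriv_dirDeriv hg]
  exact fderiv_fderiv_symm hg x a b

lemma hasDerivAt_dirDeriv {g : V → W} (hg : ContDiff ℝ ∞ g) (p w : V) (s : ℝ) :
    HasDerivAt (fun s : ℝ => g (p + s • w)) (dirDeriv w g (p + s • w)) s := by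
  have h1 : HasDerivAt (fun s : ℝ => p + s • w) w s := by
    simpa using ((hasDerivAt_id s).smul_const w).const_add p
  exact ((differentiable_of_smooth hg) _).hasFDerivAt.comp_hasDerivAt s h1

lemma dirDeriv_sum {ι : Type*} [Fintype ι] {g : ι → V → W} (hg : ∀ i, ContDiff ℝ ∞ (g i)) (w : V) :
    dirDeriv w (fun x => ∑ i, g i x) = fun x => ∑ i, dirDeriv w (g i) x := by
  ext x
  unfold dirDeriv
  rw [fderiv_fun_sum fun i _ => differentiable_of_smooth (hg i) x]
  simp

lemma dirDeriv_mul {g k : V → ℝ} (hg : ContDiff ℝ ∞ g) (hk : ContDiff ℝ ∞ k) (w : V) :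
    dirDeriv w (fun x => g x * k x) = fun x => g x * dirDeriv w k x + dirDeriv w g x * k x := by
  ext x
  unfold dirDeriv
  rw [fderiv_fun_mul (differentiable_of_smooth hg x) (differentiable_of_smooth hk x)]
  simp [mul_comm]

lemma dirDeriv_add {g k : V → W} (hg : ContDiff ℝ ∞ g) (hk : ContDiff ℝ ∞ k) (w : V) :
    dirDeriv w (fun x => g x + k x) = fun x => dirDeriv w g x + dirDeriv w k x := by
  ext x
  unfold dirDeriv
  rw [fderiv_fun_add (differentiable_of_smooth hg x) (differentiable_of_smooth hk x)]
  simp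

lemma dirDeriv_sub {g k : V → W} (hg : ContDiff ℝ ∞ g) (hk : ContDiff ℝ ∞ k) (w : V) :
    dirDeriv w (fun x => g x - k x) = fun x => dirDeriv w g x - dirDeriv w k x := by
  ext x
  unfold dirDeriv
  rw [fderiv_fun_sub (differentiable_of_smooth hg x) (differentiable_of_smooth hk x)]
  simp

lemma dirDeriv_const_mul {g : V → ℝ} (hg : ContDiff ℝ ∞ g) (c : ℝ) (w : V) :
    dirDeriv w (fun x => c * g x) = fun x => c * dirDeriv w g x := by
  ext x
  unfold dirDeriv
  rw [fderiv_const_mul (differentiable_of_smooth hg x)]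
  simp

lemma dirDeriv_clm (A : V →L[ℝ] W) (w : V) : dirDeriv w A = fun _ => A w := by
  ext x
  unfold dirDeriv
  rw [A.fderiv]

/-- The second-order chain rule for a `C^{1,1}` outer function, as an inequality. -/
lemma abs_dirDeriv_comp_sub_le {X : V → W} (hX : ContDiff ℝ ∞ X) {H : V → ℝ}
    (hH : ContDiff ℝ ∞ H) {f : W → ℝ} {U : Set W} {p : V} {Λ : ℝ} (hU : ∀ᶠ x in 𝓝 p, X x ∈ U)
    (hf : ∀ y ∈ U, DifferentiableAt ℝ f y)
    (hLip : ∀ y ∈ U, ∀ z ∈ U, ‖fderiv ℝ f y - fderiv ℝ f z‖ ≤ Λ * ‖y - z‖)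
    (hHf : ∀ᶠ x in 𝓝 p, H x = f (X x)) (w : V) :
    dirDeriv w H p = fderiv ℝ f (X p) (dirDeriv w X p) ∧
    |dirDeriv w (dirDeriv w H) p - fderiv ℝ f (X p) (dirDeriv w (dirDeriv w X) p)| ≤
      Λ * ‖dirDeriv w X p‖ ^ 2 := by
  have hD : ∀ᶠ x in 𝓝 p, dirDeriv w H x = fderiv ℝ f (X x) (dirDeriv w X x) := by
    filter_upwards [hHf.eventually_nhds, hU] with x hx hxU
    have h1 : HasFDerivAt (f ∘ X) ((fderiv ℝ f (X x)).comp (fderiv ℝ X x)) x :=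
      (hf _ hxU).hasFDerivAt.comp x (differentiable_of_smooth hX x).hasFDerivAt
    have h2 : H =ᶠ[𝓝 x] f ∘ X := hx
    unfold dirDeriv
    rw [h2.fderiv_eq, h1.fderiv]
    rfl
  have hp := hD.self_of_nhds
  refine ⟨hp, ?_⟩
  set A := fderiv ℝ f (X p) with hA
  have hline : Tendsto (fun s : ℝ => p + s • w) (𝓝[≠] 0) (𝓝 p) := by
    have : Continuous fun s : ℝ => p + s • w := by fun_prop
    have h := this.tendsto 0
    simp only [zero_smul, add_zero] at h
    exact h.mono_left nhdsWithin_le_nhds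
  -- The differential of f is frozen at X p, so f is never differentiated twice. The difference
  -- quotient then sees only the increment of the differential, which the Lipschitz bound controls.
  have hψ : HasDerivAt (fun s : ℝ => dirDeriv w H (p + s • w) - A (dirDeriv w X (p + s • w)))
      (dirDeriv w (dirDeriv w H) p - A (dirDeriv w (dirDeriv w X) p)) 0 := by
    have h1 := hasDerivAt_dirDeriv (contDiff_dirDeriv hH w) p w 0
    have h2 := hasDerivAt_dirDeriv (contDiff_dirDeriv hX w) p w 0
    have h3 := A.hasFDerivAt.comp_hasDerivAt (0 : ℝ) h2
    have h4 := h1.sub h3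
    simp only [zero_smul, add_zero] at h4
    exact h4
  have hXd := hasDerivAt_dirDeriv hX p w 0
  rw [hasDerivAt_iff_tendsto_slope_zero] at hψ hXd
  simp only [zero_add, zero_smul, add_zero, hp, sub_self, sub_zero] at hψ hXd
  have hX1 : Tendsto (fun s : ℝ => dirDeriv w X (p + s • w)) (𝓝[≠] 0) (𝓝 (dirDeriv w X p)) :=
    ((contDiff_dirDeriv hX w).continuous.tendsto p).comp hline
  have hlim : Tendsto (fun s : ℝ => Λ * ‖s⁻¹ • (X (p + s • w) - X p)‖ * ‖dirDeriv w X (p + s • w)‖)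
      (𝓝[≠] 0) (𝓝 (Λ * ‖dirDeriv w X p‖ * ‖dirDeriv w X p‖)) :=
    (hXd.norm.const_mul Λ).mul hX1.norm
  rw [← Real.norm_eq_abs, pow_two, ← mul_assoc]
  refine le_of_tendsto_of_tendsto hψ.norm hlim ?_
  filter_upwards [hline.eventually hD, hline.eventually hU] with s h1 h2
  rw [h1, ← sub_apply, norm_smul, norm_smul]
  calc ‖s⁻¹‖ * ‖(fderiv ℝ f (X (p + s • w)) - A) (dirDeriv w X (p + s • w))‖
      ≤ ‖s⁻¹‖ * ((Λ * ‖X (p + s • w) - X p‖) * ‖dirDeriv w X (p + s • w)‖) := by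
        gcongr
        refine (ContinuousLinearMap.le_opNorm _ _).trans ?_
        gcongr
        exact hLip _ h2 _ hU.self_of_nhds
    _ = _ := by ring

end Directional

/-! ### The maximum principle along a line -/

lemma second_deriv_nonpos_of_isLocalMax {P F : ℝ → ℝ} {D : ℝ} (hP : ∀ᶠ s in 𝓝 0, HasDerivAt P (F s) s)
    (hF : HasDerivAt F D 0) (hmax : IsLocalMax P 0) : F 0 = 0 ∧ D ≤ 0 := by
  have h0 := hP.self_of_nhds
  have hz : F 0 = 0 := hmax.hasDerivAt_eq_zero h0
  refine ⟨hz, ?_⟩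
  by_contra! hD
  have hd : deriv P =ᶠ[𝓝 0] F := hP.mono fun s hs => hs.deriv
  have hdd : deriv (deriv P) 0 = D := by rw [hd.deriv_eq, hF.deriv]
  have hmin := isLocalMin_of_deriv_deriv_pos (by rw [hdd]; exact hD) (by rw [h0.deriv, hz])
    h0.continuousAt
  have hc : P =ᶠ[𝓝 0] fun _ => P 0 := by
    filter_upwards [hmin, hmax] with s h1 h2
    exact le_antisymm h2 h1
  have : deriv (deriv P) 0 = 0 := by
    rw [hc.deriv.deriv_eq]
    simp
  linarith

lemma local_max_log_test {r r₁ φ φ₁ S S₁ : ℝ → ℝ} {r₂ φ₂ S₂ m : ℝ}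
    (hr : ∀ s, HasDerivAt r (r₁ s) s) (hr₁ : HasDerivAt r₁ r₂ 0)
    (hφ : ∀ s, HasDerivAt φ (φ₁ s) s) (hφ₁ : HasDerivAt φ₁ φ₂ 0)
    (hS : ∀ s, HasDerivAt S (S₁ s) s) (hS₁ : HasDerivAt S₁ S₂ 0)
    (hr0 : 0 < r 0) (hS0 : 0 < S 0) (hb : 0 < Real.log (S 0) - m)
    (hmax : IsLocalMax (fun s => r s ^ 2 * Real.exp (φ s) * (Real.log (S s) - m)) 0) :
    2 * (r₁ 0 / r 0) + φ₁ 0 + S₁ 0 / S 0 / (Real.log (S 0) - m) = 0 ∧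
    2 * ((r₂ * r 0 - r₁ 0 * r₁ 0) / r 0 ^ 2) + φ₂ +
      ((S₂ * S 0 - S₁ 0 * S₁ 0) / S 0 ^ 2 * (Real.log (S 0) - m) - S₁ 0 / S 0 * (S₁ 0 / S 0)) /
        (Real.log (S 0) - m) ^ 2 ≤ 0 := by
  have er : ∀ᶠ s in 𝓝 0, 0 < r s := (hr 0).continuousAt.eventually_const_lt hr0
  have eS : ∀ᶠ s in 𝓝 0, 0 < S s := (hS 0).continuousAt.eventually_const_lt hS0
  have hlog : HasDerivAt (fun s => Real.log (S s) - m) (S₁ 0 / S 0) 0 :=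
    ((hS 0).log hS0.ne').sub_const m
  have eb : ∀ᶠ s in 𝓝 0, 0 < Real.log (S s) - m := hlog.continuousAt.eventually_const_lt hb
  refine second_deriv_nonpos_of_isLocalMax
    (P := fun s => 2 * Real.log (r s) + φ s + Real.log (Real.log (S s) - m))
    (F := fun s => 2 * (r₁ s / r s) + φ₁ s + S₁ s / S s / (Real.log (S s) - m)) ?_ ?_ ?_
  · filter_upwards [er, eS, eb] with s h1 h2 h3
    exact ((((hr s).log h1.ne').const_mul 2).add (hφ s)).add
      ((((hS s).log h2.ne').sub_const m).log h3.ne')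
  · exact (((hr₁.div (hr 0) hr0.ne').const_mul 2).add hφ₁).add
      ((hS₁.div (hS 0) hS0.ne').div hlog hb.ne')
  · filter_upwards [er, eS, eb, hmax] with s h1 h2 h3 h4
    have key : ∀ a b c : ℝ, 0 < a → 0 < c →
        Real.log (a ^ 2 * Real.exp b * c) = 2 * Real.log a + b + Real.log c := by
      intro a b c ha hc
      rw [Real.log_mul (by positivity) hc.ne', Real.log_mul (by positivity) (Real.exp_ne_zero _),
        Real.log_exp, Real.log_pow]
      norm_num
    rw [← key _ _ _ h1 h3, ← key _ _ _ hr0 hb]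
    exact Real.log_le_log (by positivity) h4

/-! ### The Hessian in an orthonormal frame -/

lemma two_mul_esymm_two (s : Multiset ℝ) :
    2 * s.esymm 2 = s.sum ^ 2 - (s.map (· ^ 2)).sum := by
  have h1 : ∀ t : Multiset ℝ, t.esymm 1 = t.sum := by
    intro t
    simp [Multiset.esymm, Multiset.powersetCard_one]
  induction s using Multiset.induction_on with
  | empty => simp [Multiset.esymm, Multiset.powersetCard_zero_right 1]
  | cons a s ih =>
    have h2 : (a ::ₘ s).esymm 2 = s.esymm 2 + a * s.esymm 1 := by
      simp [Multiset.esymm, Multiset.powersetCard_cons, Multiset.sum_map_mul_left]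
    rw [h2, h1, mul_add, ih]
    simp
    ring

lemma esymm_one (s : Multiset ℝ) : s.esymm 1 = s.sum := by
  simp [Multiset.esymm, Multiset.powersetCard_one]

/-- Parseval in each slot: the Hilbert–Schmidt norm is independent of the frame. This lets σ₂ be
computed in a fixed frame rather than in eigenframes varying with the point. -/
lemma sum_sq_bilinear {n : ℕ} (B : E n →L[ℝ] E n →L[ℝ] ℝ) (hB : ∀ a b, B a b = B b a)
    (v w : OrthonormalBasis (Fin n) ℝ (E n)) :
    ∑ i, ∑ j, B (v i) (v j) ^ 2 = ∑ i, ∑ j, B (w i) (w j) ^ 2 := by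
  have key : ∀ (A : E n →L[ℝ] ℝ), ∑ j, A (v j) ^ 2 = ∑ j, A (w j) ^ 2 := by
    intro A
    have h : ∀ b : OrthonormalBasis (Fin n) ℝ (E n), ∑ j, A (b j) ^ 2 =
        ‖(InnerProductSpace.toDual ℝ (E n)).symm A‖ ^ 2 := by
      intro b
      rw [← b.sum_sq_norm_inner_right]
      refine Finset.sum_congr rfl fun j _ => ?_
      rw [real_inner_comm, InnerProductSpace.toDual_symm_apply, Real.norm_eq_abs, sq_abs]
    rw [h, h]
  calc ∑ i, ∑ j, B (v i) (v j) ^ 2 = ∑ i, ∑ j, B (v i) (w j) ^ 2 :=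
        Finset.sum_congr rfl fun i _ => key (B (v i))
    _ = ∑ j, ∑ i, B (w j) (v i) ^ 2 := by
        rw [Finset.sum_comm]
        simp_rw [fun i j => hB (v i) (w j)]
    _ = _ := Finset.sum_congr rfl fun i _ => key (B (w i))

section Frame

variable {n : ℕ} {u : E n → ℝ}

lemma hessian_apply (u : E n → ℝ) (x : E n) (i j : Fin n) :
    hessian u x i j = fderiv ℝ (fderiv ℝ u) x (EuclideanSpace.single i 1)
      (EuclideanSpace.single j 1) := by
  simp [hessian, iteratedFDeriv_two_apply]

lemma hessian_isHermitian (hu : ContDiff ℝ ∞ u) (x : E n) : (hessian u x).IsHermitian := by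
  ext i j
  rw [Matrix.conjTranspose_apply, hessian_apply, hessian_apply]
  exact fderiv_fderiv_symm hu x _ _

lemma bilinear_eq_dotProduct (u : E n → ℝ) (x a b : E n) :
    fderiv ℝ (fderiv ℝ u) x a b = dotProduct a.ofLp ((hessian u x).mulVec b.ofLp) := by
  have ha : a = ∑ i, a i • EuclideanSpace.single i (1 : ℝ) := by
    ext j; simp [Finset.sum_apply, Pi.single_apply]
  have hb : b = ∑ i, b i • EuclideanSpace.single i (1 : ℝ) := by
    ext j; simp [Finset.sum_apply, Pi.single_apply]
  conv_lhs => rw [ha, hb]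
  simp only [map_sum, map_smul, sum_apply, smul_apply,
    smul_eq_mul, ← hessian_apply, dotProduct, Matrix.mulVec, Finset.mul_sum]
  rw [Finset.sum_comm]
  refine Finset.sum_congr rfl fun i _ => Finset.sum_congr rfl fun j _ => ?_
  ring

/-- An orthonormal frame diagonalizing the Hessian at a point. -/
lemma exists_eigenframe (hu : ContDiff ℝ ∞ u) (x : E n) :
    ∃ (v : OrthonormalBasis (Fin n) ℝ (E n)) (lam : Fin n → ℝ),
      (∀ i j, fderiv ℝ (fderiv ℝ u) x (v i) (v j) = if i = j then lam i else 0) ∧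
      hessianEigenvalues u x = Finset.univ.val.map lam := by
  have hA := hessian_isHermitian hu x
  refine ⟨hA.eigenvectorBasis, hA.eigenvalues, fun i j => ?_, ?_⟩
  · rw [bilinear_eq_dotProduct, hA.mulVec_eigenvectorBasis, dotProduct_smul]
    have h1 := (orthonormal_iff_ite.1 hA.eigenvectorBasis.orthonormal) j i
    rw [EuclideanSpace.inner_eq_star_dotProduct] at h1
    simp only [star_trivial] at h1
    rw [h1]
    by_cases hij : i = j
    · subst hij; simp
    · simp [hij, Ne.symm hij]
  · rw [hessianEigenvalues, hA.roots_charpoly_eq_eigenvalues]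
    rfl

lemma laplacian_eq_sum (hu : ContDiff ℝ ∞ u) (v : OrthonormalBasis (Fin n) ℝ (E n)) :
    Δ u = fun x => ∑ i, dirDeriv (v i) (dirDeriv (v i) u) x := by
  rw [InnerProductSpace.laplacian_eq_iteratedFDeriv_orthonormalBasis u v]
  ext x
  refine Finset.sum_congr rfl fun i _ => ?_
  rw [dirDeriv_dirDeriv hu, iteratedFDeriv_two_apply]
  simp

lemma sigma_one_eq (hu : ContDiff ℝ ∞ u) (x : E n) : sigma 1 u x = Δ u x := by
  obtain ⟨v, lam, h1, h2⟩ := exists_eigenframe hu x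
  rw [sigma, esymm_one, h2, laplacian_eq_sum hu v]
  simp [dirDeriv_dirDeriv hu, h1, List.sum_ofFn]

lemma two_mul_sigma_two (hu : ContDiff ℝ ∞ u) (v : OrthonormalBasis (Fin n) ℝ (E n)) (x : E n) :
    2 * sigma 2 u x =
      Δ u x ^ 2 - ∑ i, ∑ j, dirDeriv (v i) (dirDeriv (v j) u) x ^ 2 := by
  obtain ⟨w, lam, h1, h2⟩ := exists_eigenframe hu x
  have h3 := sum_sq_bilinear (fderiv ℝ (fderiv ℝ u) x)
    (fderiv_fderiv_symm hu x) v w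
  have h4 : ∑ i, ∑ j, (fderiv ℝ (fderiv ℝ u) x (w i) (w j)) ^ 2 = ∑ i, lam i ^ 2 := by
    simp [h1]
  simp_rw [dirDeriv_dirDeriv hu]
  rw [h3, h4, ← sigma_one_eq hu, sigma, sigma, two_mul_esymm_two, esymm_one, h2]
  simp [List.sum_ofFn]

lemma smooth_laplacian (hu : ContDiff ℝ ∞ u) : ContDiff ℝ ∞ (Δ u) := by
  rw [laplacian_eq_sum hu (EuclideanSpace.basisFun (Fin n) ℝ)]
  exact ContDiff.sum fun i _ => contDiff_dirDeriv (contDiff_dirDeriv hu _) _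

lemma lambdaMin_le {x : E n} {lam : Fin n → ℝ}
    (h : hessianEigenvalues u x = Finset.univ.val.map lam) (k : Fin n) : lambdaMin u x ≤ lam k := by
  have hset : {μ : ℝ | μ ∈ hessianEigenvalues u x} = Set.range lam := by
    rw [h]
    ext μ
    simp
  rw [lambdaMin, hset]
  exact csInf_le (Set.finite_range lam).bddBelow ⟨k, rfl⟩

end Frame

/-! ### The differentiated equation -/

section Equation

variable {n : ℕ} {u : E n → ℝ}

lemma sigma_two_eq (hu : ContDiff ℝ ∞ u) (v : OrthonormalBasis (Fin n) ℝ (E n)) :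
    sigma 2 u = fun x => 1 / 2 * (Δ u x * Δ u x -
      ∑ i, ∑ j, dirDeriv (v i) (dirDeriv (v j) u) x * dirDeriv (v i) (dirDeriv (v j) u) x) := by
  ext x
  have := two_mul_sigma_two hu v x
  simp_rw [← pow_two]
  linarith

lemma smooth_sigma_two (hu : ContDiff ℝ ∞ u) : ContDiff ℝ ∞ (sigma 2 u) := by
  rw [sigma_two_eq hu (EuclideanSpace.basisFun (Fin n) ℝ)]
  have h := smooth_laplacian hu
  refine contDiff_const.mul ((h.mul h).sub (ContDiff.sum fun i _ => ContDiff.sum fun j _ => ?_))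
  have h2 := contDiff_dirDeriv (contDiff_dirDeriv hu
    (EuclideanSpace.basisFun (Fin n) ℝ j)) (EuclideanSpace.basisFun (Fin n) ℝ i)
  exact h2.mul h2

lemma dirDeriv_sigma_two (hu : ContDiff ℝ ∞ u) (v : OrthonormalBasis (Fin n) ℝ (E n)) (w : E n) :
    dirDeriv w (sigma 2 u) = fun x => Δ u x * dirDeriv w (Δ u) x -
      ∑ i, ∑ j, dirDeriv (v i) (dirDeriv (v j) u) x *
        dirDeriv w (dirDeriv (v i) (dirDeriv (v j) u)) x := by
  have h := smooth_laplacian hu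
  have h2 : ∀ i j, ContDiff ℝ ∞ (dirDeriv (v i) (dirDeriv (v j) u)) := fun i j =>
    contDiff_dirDeriv (contDiff_dirDeriv hu _) _
  have h3 : ∀ i, ContDiff ℝ ∞ fun x => ∑ j, dirDeriv (v i) (dirDeriv (v j) u) x *
      dirDeriv (v i) (dirDeriv (v j) u) x := fun i =>
    ContDiff.sum fun j _ => (h2 i j).mul (h2 i j)
  have h4 : ContDiff ℝ ∞ fun x => ∑ i, ∑ j, dirDeriv (v i) (dirDeriv (v j) u) x *
      dirDeriv (v i) (dirDeriv (v j) u) x := ContDiff.sum fun i _ => h3 i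
  rw [sigma_two_eq hu v, dirDeriv_const_mul ((h.mul h).sub h4), dirDeriv_sub (h.mul h) h4,
    dirDeriv_mul h h, dirDeriv_sum h3]
  ext x
  simp only
  simp_rw [dirDeriv_sum fun j => (h2 _ j).mul (h2 _ j), dirDeriv_mul (h2 _ _) (h2 _ _),
    Finset.sum_add_distrib]
  simp_rw [mul_comm (dirDeriv w _ x)]
  ring

lemma dirDeriv_dirDeriv_sigma_two (hu : ContDiff ℝ ∞ u)
    (v : OrthonormalBasis (Fin n) ℝ (E n)) (w x : E n) :
    dirDeriv w (dirDeriv w (sigma 2 u)) x =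
      Δ u x * dirDeriv w (dirDeriv w (Δ u)) x + dirDeriv w (Δ u) x ^ 2 -
      ∑ i, ∑ j, (dirDeriv (v i) (dirDeriv (v j) u) x *
        dirDeriv w (dirDeriv w (dirDeriv (v i) (dirDeriv (v j) u))) x +
        dirDeriv w (dirDeriv (v i) (dirDeriv (v j) u)) x ^ 2) := by
  have h := smooth_laplacian hu
  have h' := contDiff_dirDeriv h w
  have h2 : ∀ i j, ContDiff ℝ ∞ (dirDeriv (v i) (dirDeriv (v j) u)) := fun i j =>
    contDiff_dirDeriv (contDiff_dirDeriv hu _) _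
  have h2' := fun i j => contDiff_dirDeriv (h2 i j) w
  have h3 : ∀ i, ContDiff ℝ ∞ fun x => ∑ j, dirDeriv (v i) (dirDeriv (v j) u) x *
      dirDeriv w (dirDeriv (v i) (dirDeriv (v j) u)) x := fun i =>
    ContDiff.sum fun j _ => (h2 i j).mul (h2' i j)
  have h4 : ContDiff ℝ ∞ fun x => ∑ i, ∑ j, dirDeriv (v i) (dirDeriv (v j) u) x *
      dirDeriv w (dirDeriv (v i) (dirDeriv (v j) u)) x := ContDiff.sum fun i _ => h3 i
  rw [dirDeriv_sigma_two hu v, dirDeriv_sub (h.mul h') h4, dirDeriv_mul h h', dirDeriv_sum h3]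
  simp_rw [dirDeriv_sum fun j => (h2 _ j).mul (h2' _ j), dirDeriv_mul (h2 _ _) (h2' _ _), pow_two]

variable {v : OrthonormalBasis (Fin n) ℝ (E n)} {p : E n} {lam : Fin n → ℝ}

lemma third_symm_left (hu : ContDiff ℝ ∞ u) (i j k : Fin n) :
    dirDeriv (v i) (dirDeriv (v j) (dirDeriv (v k) u)) p =
      dirDeriv (v j) (dirDeriv (v i) (dirDeriv (v k) u)) p := by
  rw [dirDeriv_comm (contDiff_dirDeriv hu _)]

lemma third_symm_right (hu : ContDiff ℝ ∞ u) (i j k : Fin n) :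
    dirDeriv (v i) (dirDeriv (v j) (dirDeriv (v k) u)) p =
      dirDeriv (v i) (dirDeriv (v k) (dirDeriv (v j) u)) p := by
  rw [dirDeriv_comm hu (v j)]

lemma dirDeriv_laplacian (hu : ContDiff ℝ ∞ u) (v : OrthonormalBasis (Fin n) ℝ (E n)) (w : E n) :
    dirDeriv w (Δ u) = fun x => ∑ i, dirDeriv (v i) (dirDeriv (v i) (dirDeriv w u)) x := by
  have h2 : ∀ i, ContDiff ℝ ∞ (dirDeriv (v i) (dirDeriv (v i) u)) := fun i =>
    contDiff_dirDeriv (contDiff_dirDeriv hu _) _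
  rw [laplacian_eq_sum hu v, dirDeriv_sum h2]
  ext x
  refine Finset.sum_congr rfl fun i _ => ?_
  rw [dirDeriv_comm (contDiff_dirDeriv hu _) w, dirDeriv_comm hu w]

/-- The once differentiated equation in an eigenframe. -/
lemma dirDeriv_sigma_two_frame (hu : ContDiff ℝ ∞ u)
    (hdiag : ∀ i j, dirDeriv (v i) (dirDeriv (v j) u) p = if i = j then lam i else 0) (k : Fin n) :
    dirDeriv (v k) (sigma 2 u) p =
      ∑ i, (Δ u p - lam i) * dirDeriv (v i) (dirDeriv (v i) (dirDeriv (v k) u)) p := by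
  rw [dirDeriv_sigma_two hu v, dirDeriv_laplacian hu v]
  simp only [hdiag, ite_mul, zero_mul, Finset.sum_ite_eq, Finset.mem_univ, if_true, sub_mul,
    Finset.sum_sub_distrib, ← Finset.mul_sum]
  congr 1
  refine Finset.sum_congr rfl fun i _ => ?_
  rw [third_symm_left hu k i i, third_symm_right hu i k i]

/-- The trace of the twice differentiated equation in an eigenframe. -/
lemma sum_dirDeriv_dirDeriv_sigma_two_frame (hu : ContDiff ℝ ∞ u)
    (hdiag : ∀ i j, dirDeriv (v i) (dirDeriv (v j) u) p = if i = j then lam i else 0) :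
    ∑ k, dirDeriv (v k) (dirDeriv (v k) (sigma 2 u)) p =
      ∑ k, (∑ i, dirDeriv (v i) (dirDeriv (v i) (dirDeriv (v k) u)) p) ^ 2 -
      ∑ k, ∑ i, ∑ j, dirDeriv (v i) (dirDeriv (v j) (dirDeriv (v k) u)) p ^ 2 +
      ∑ k, (Δ u p - lam k) * dirDeriv (v k) (dirDeriv (v k) (Δ u)) p := by
  -- Commuting derivatives turns the fourth-order terms into second derivatives of Δu, completing
  -- the linearized operator applied to Δu.
  have h4 : ∑ k, ∑ i, lam i * dirDeriv (v k) (dirDeriv (v k) (dirDeriv (v i) (dirDeriv (v i) u))) p =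
      ∑ i, lam i * dirDeriv (v i) (dirDeriv (v i) (Δ u)) p := by
    rw [Finset.sum_comm]
    refine Finset.sum_congr rfl fun i _ => ?_
    rw [← Finset.mul_sum]
    congr 1
    have e := dirDeriv_laplacian (contDiff_dirDeriv hu (v i)) v (v i)
    have e2 : dirDeriv (v i) (Δ u) = Δ (dirDeriv (v i) u) := by
      rw [dirDeriv_laplacian hu v, laplacian_eq_sum (contDiff_dirDeriv hu _) v]
    rw [e2, e]
  have h5 : ∑ k, ∑ i, ∑ j, dirDeriv (v k) (dirDeriv (v i) (dirDeriv (v j) u)) p ^ 2 =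
      ∑ k, ∑ i, ∑ j, dirDeriv (v i) (dirDeriv (v j) (dirDeriv (v k) u)) p ^ 2 := by
    refine Finset.sum_congr rfl fun k _ => Finset.sum_congr rfl fun i _ =>
      Finset.sum_congr rfl fun j _ => ?_
    rw [third_symm_left hu k i j, third_symm_right hu i k j]
  simp_rw [dirDeriv_dirDeriv_sigma_two hu v, hdiag, ite_mul, zero_mul, Finset.sum_add_distrib,
    Finset.sum_sub_distrib, Finset.sum_add_distrib, Finset.sum_ite_eq, Finset.mem_univ, if_true,
    sub_mul, Finset.sum_sub_distrib, ← Finset.mul_sum]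
  rw [h4, h5]
  simp_rw [dirDeriv_laplacian hu v]
  ring

end Equation

/-! ### The right-hand side -/

section RightHandSide

variable {n : ℕ} {u : E n → ℝ}

lemma gradient_eq_sum (u : E n → ℝ) (v : OrthonormalBasis (Fin n) ℝ (E n)) (x : E n) :
    ∇ u x = ∑ j, dirDeriv (v j) u x • v j := by
  rw [← v.sum_repr (∇ u x)]
  refine Finset.sum_congr rfl fun j _ => ?_
  rw [v.repr_apply_apply, real_inner_comm, inner_gradient_left]
  rfl

/-- The 1-jet of `u`, the argument of the right-hand side. -/
noncomputable def jet (u : E n → ℝ) (x : E n) : E n × ℝ × E n := (x, u x, ∇ u x)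

lemma smooth_jet (hu : ContDiff ℝ ∞ u) : ContDiff ℝ ∞ (jet u) := by
  have : ∇ u = fun x => (InnerProductSpace.toDual ℝ (E n)).symm (fderiv ℝ u x) := rfl
  refine contDiff_id.prodMk (hu.prodMk ?_)
  rw [this]
  exact (InnerProductSpace.toDual ℝ (E n)).symm.contDiff.comp
    (hu.fderiv_right (m := ∞) (by simp))

lemma dirDeriv_jet (hu : ContDiff ℝ ∞ u) (v : OrthonormalBasis (Fin n) ℝ (E n)) (w : E n) :
    dirDeriv w (jet u) = fun x =>
      (w, dirDeriv w u x, ∑ j, dirDeriv w (dirDeriv (v j) u) x • v j) := by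
  have hd : ∀ j, Differentiable ℝ (dirDeriv (v j) u) := fun j =>
    differentiable_of_smooth (contDiff_dirDeriv hu _)
  have hj : jet u = fun x => (x, u x, ∑ j, dirDeriv (v j) u x • v j) := by
    ext1 x; rw [jet, gradient_eq_sum u v]
  ext1 x
  have h := (hasFDerivAt_id (𝕜 := ℝ) x).prodMk ((differentiable_of_smooth hu x).hasFDerivAt.prodMk
    (HasFDerivAt.fun_sum fun j (_ : j ∈ Finset.univ) => (hd j x).hasFDerivAt.smul_const (v j)))
  rw [hj]
  unfold dirDeriv at h ⊢
  erw [h.fderiv]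
  simp

lemma dirDeriv_dirDeriv_jet (hu : ContDiff ℝ ∞ u) (v : OrthonormalBasis (Fin n) ℝ (E n))
    (w : E n) :
    dirDeriv w (dirDeriv w (jet u)) = fun x =>
      (0, dirDeriv w (dirDeriv w u) x,
        ∑ j, dirDeriv w (dirDeriv w (dirDeriv (v j) u)) x • v j) := by
  have hd : ∀ j, Differentiable ℝ (dirDeriv w (dirDeriv (v j) u)) := fun j =>
    differentiable_of_smooth (contDiff_dirDeriv (contDiff_dirDeriv hu _) _)
  have hd1 := differentiable_of_smooth (contDiff_dirDeriv hu w)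
  rw [dirDeriv_jet hu v]
  ext1 x
  have h := (hasFDerivAt_const (𝕜 := ℝ) w x).prodMk ((hd1 x).hasFDerivAt.prodMk
    (HasFDerivAt.fun_sum fun j (_ : j ∈ Finset.univ) => (hd j x).hasFDerivAt.smul_const (v j)))
  unfold dirDeriv at h ⊢
  erw [h.fderiv]
  simp

end RightHandSide

/-! ### The test function and its interior maxima -/

section MaximumPoint

variable {n : ℕ} {u : E n → ℝ}

lemma abs_clm_apply_le {W : Type*} [NormedAddCommGroup W] [NormedSpace ℝ W] {A : W →L[ℝ] ℝ} {L : ℝ}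
    (hA : ‖A‖ ≤ L) {w : W} (hw : ‖w‖ ≤ 1) : |A w| ≤ L := by
  rw [← Real.norm_eq_abs]
  calc ‖A w‖ ≤ ‖A‖ * ‖w‖ := A.le_opNorm w
    _ ≤ L * 1 := mul_le_mul hA hw (norm_nonneg _) ((norm_nonneg _).trans hA)
    _ = L := mul_one L

/-- First and second derivatives of the right-hand side in an eigenframe. -/
lemma rhs_frame (hu : ContDiff ℝ ∞ u) {f : E n × ℝ × E n → ℝ} {U : Set (E n × ℝ × E n)}
    {p : E n} {L : ℝ} (hU : ∀ᶠ x in 𝓝 p, jet u x ∈ U) (hf : ∀ y ∈ U, DifferentiableAt ℝ f y)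
    (hDf : ∀ y ∈ U, ‖fderiv ℝ f y‖ ≤ L)
    (hLip : ∀ y ∈ U, ∀ z ∈ U, ‖fderiv ℝ f y - fderiv ℝ f z‖ ≤ L * ‖y - z‖)
    (heq : ∀ᶠ x in 𝓝 p, sigma 2 u x = f (jet u x))
    {v : OrthonormalBasis (Fin n) ℝ (E n)} {lam : Fin n → ℝ}
    (hdiag : ∀ i j, dirDeriv (v i) (dirDeriv (v j) u) p = if i = j then lam i else 0) :
    ∃ (Ax a : Fin n → ℝ) (Az : ℝ), (∀ k, |Ax k| ≤ L) ∧ (∀ k, |a k| ≤ L) ∧ |Az| ≤ L ∧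
      (∀ k, dirDeriv (v k) (sigma 2 u) p = Ax k + Az * dirDeriv (v k) u p + lam k * a k) ∧
      Az * Δ u p +
        ∑ k, (∑ i, dirDeriv (v i) (dirDeriv (v i) (dirDeriv (v k) u)) p) * a k -
        L * ∑ k, (1 + |dirDeriv (v k) u p| + |lam k|) ^ 2 ≤
        ∑ k, dirDeriv (v k) (dirDeriv (v k) (sigma 2 u)) p := by
  have hp := hU.self_of_nhds
  have hL0 : 0 ≤ L := (norm_nonneg _).trans (hDf _ hp)
  have hmain := fun k => abs_dirDeriv_comp_sub_le (smooth_jet hu) (smooth_sigma_two hu) hU hf hLip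
    heq (v k)
  set A := fderiv ℝ f (jet u p) with hA
  have hAL : ‖A‖ ≤ L := hDf _ hp
  have hv : ∀ k, ‖v k‖ = 1 := fun k => v.orthonormal.1 k
  have hdec : ∀ (a : E n) (t : ℝ) (b : E n), A (a, t, b) = A (a, 0, 0) + t * A (0, 1, 0) +
      A (0, 0, b) := by
    intro a t b
    rw [← smul_eq_mul, ← map_smul, ← map_add, ← map_add]
    simp
  have hdecs : ∀ c : Fin n → ℝ, A (0, 0, ∑ j, c j • v j) = ∑ j, c j * A (0, 0, v j) := by
    intro c
    have : ((0, 0, ∑ j, c j • v j) : E n × ℝ × E n) = ∑ j, c j • ((0, 0, v j) : E n × ℝ × E n) := by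
      ext1
      · simp [Prod.fst_sum]
      · ext1
        · simp [Prod.fst_sum, Prod.snd_sum]
        · simp [Prod.snd_sum]
    rw [this, map_sum]
    exact Finset.sum_congr rfl fun j _ => by rw [map_smul, smul_eq_mul]
  have hX1 : ∀ k, dirDeriv (v k) (jet u) p = (v k, dirDeriv (v k) u p, lam k • v k) := by
    intro k
    rw [dirDeriv_jet hu v]
    simp [hdiag]
  refine ⟨fun k => A (v k, 0, 0), fun k => A (0, 0, v k), A (0, 1, 0), fun k => ?_, fun k => ?_, ?_,
    fun k => ?_, ?_⟩
  · exact abs_clm_apply_le hAL (by simp [Prod.norm_def, hv])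
  · exact abs_clm_apply_le hAL (by simp [Prod.norm_def, hv])
  · exact abs_clm_apply_le hAL (by simp [Prod.norm_def])
  · rw [(hmain k).1, hX1, hdec]
    have : A (0, 0, lam k • v k) = lam k * A (0, 0, v k) := by
      have e : ((0, 0, lam k • v k) : E n × ℝ × E n) = lam k • ((0, 0, v k) : E n × ℝ × E n) := by
        simp
      rw [e, map_smul, smul_eq_mul]
    rw [this]
    ring
  · have h1 : ∀ k, dirDeriv (v k) (dirDeriv (v k) u) p * A (0, 1, 0) +
        ∑ j, dirDeriv (v k) (dirDeriv (v k) (dirDeriv (v j) u)) p * A (0, 0, v j) -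
        L * (1 + |dirDeriv (v k) u p| + |lam k|) ^ 2 ≤
        dirDeriv (v k) (dirDeriv (v k) (sigma 2 u)) p := by
      intro k
      have h2 := (hmain k).2
      rw [hX1, dirDeriv_dirDeriv_jet hu v] at h2
      simp only at h2
      rw [hdec, hdecs] at h2
      have h0 : A ((0 : E n), (0 : ℝ), (0 : E n)) = 0 := map_zero A
      rw [h0] at h2
      have h3 : ‖(v k, dirDeriv (v k) u p, lam k • v k)‖ ≤
          1 + |dirDeriv (v k) u p| + |lam k| := by
        simp only [Prod.norm_def, norm_smul, hv, Real.norm_eq_abs, mul_one]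
        have e1 := abs_nonneg (dirDeriv (v k) u p)
        have e2 := abs_nonneg (lam k)
        refine max_le ?_ (max_le ?_ ?_) <;> linarith
      have h4 : L * ‖(v k, dirDeriv (v k) u p, lam k • v k)‖ ^ 2 ≤
          L * (1 + |dirDeriv (v k) u p| + |lam k|) ^ 2 := by gcongr
      have h5 := (abs_le.1 h2).1
      linarith
    have h2 := Finset.sum_le_sum fun k (_ : k ∈ Finset.univ) => h1 k
    rw [Finset.sum_sub_distrib, Finset.sum_add_distrib, ← Finset.sum_mul, ← Finset.mul_sum] at h2
    refine le_trans (le_of_eq ?_) h2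
    have e : ∑ k, (∑ i, dirDeriv (v i) (dirDeriv (v i) (dirDeriv (v k) u)) p) * A (0, 0, v k) =
        ∑ k, ∑ j, dirDeriv (v k) (dirDeriv (v k) (dirDeriv (v j) u)) p * A (0, 0, v j) := by
      simp_rw [Finset.sum_mul]
      exact Finset.sum_comm
    rw [e, laplacian_eq_sum hu v, mul_comm (A (0, 1, 0))]

/-- The exponent `α (x·Du - u) + β |Du|² / 2` of the test function. -/
noncomputable def weight (u : E n → ℝ) (α β : ℝ) (x : E n) : ℝ :=
  α * (fderiv ℝ u x x - u x) + β / 2 * ‖∇ u x‖ ^ 2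

lemma weight_eq (u : E n → ℝ) (v : OrthonormalBasis (Fin n) ℝ (E n)) (α β : ℝ) :
    weight u α β = fun x => α * ((∑ j, innerSL ℝ (v j) x * dirDeriv (v j) u x) - u x) +
      β / 2 * ∑ j, dirDeriv (v j) u x * dirDeriv (v j) u x := by
  ext x
  have h1 : fderiv ℝ u x x = ∑ j, innerSL ℝ (v j) x * dirDeriv (v j) u x := by
    have h : fderiv ℝ u x x = fderiv ℝ u x (∑ j, v.repr x j • v j) := by rw [v.sum_repr x]
    rw [h, map_sum]
    refine Finset.sum_congr rfl fun j _ => ?_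
    rw [map_smul, v.repr_apply_apply]
    rfl
  have h2 : ‖∇ u x‖ ^ 2 = ∑ j, dirDeriv (v j) u x * dirDeriv (v j) u x := by
    rw [← v.sum_sq_norm_inner_right]
    refine Finset.sum_congr rfl fun j _ => ?_
    rw [real_inner_comm, inner_gradient_left, Real.norm_eq_abs, sq_abs, pow_two]
    rfl
  rw [weight, h1, h2]

lemma smooth_weight (hu : ContDiff ℝ ∞ u) (α β : ℝ) : ContDiff ℝ ∞ (weight u α β) := by
  rw [weight_eq u (EuclideanSpace.basisFun (Fin n) ℝ)]
  have h := fun j => contDiff_dirDeriv hu (EuclideanSpace.basisFun (Fin n) ℝ j)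
  exact (contDiff_const.mul ((ContDiff.sum fun j _ =>
    (ContinuousLinearMap.contDiff _).mul (h j)).sub hu)).add
    (contDiff_const.mul (ContDiff.sum fun j _ => (h j).mul (h j)))

lemma dirDeriv_weight (hu : ContDiff ℝ ∞ u) (v : OrthonormalBasis (Fin n) ℝ (E n)) (α β : ℝ)
    (k : Fin n) :
    dirDeriv (v k) (weight u α β) = fun x =>
      α * (∑ j, innerSL ℝ (v j) x * dirDeriv (v k) (dirDeriv (v j) u) x) +
      β * ∑ j, dirDeriv (v j) u x * dirDeriv (v k) (dirDeriv (v j) u) x := by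
  have h := fun j => contDiff_dirDeriv hu (v j)
  have hl : ∀ j, ContDiff ℝ ∞ (innerSL ℝ (v j)) := fun j => ContinuousLinearMap.contDiff _
  have h1 : ContDiff ℝ ∞ fun x => ∑ j, innerSL ℝ (v j) x * dirDeriv (v j) u x :=
    ContDiff.sum fun j _ => (hl j).mul (h j)
  have h2 : ContDiff ℝ ∞ fun x => ∑ j, dirDeriv (v j) u x * dirDeriv (v j) u x :=
    ContDiff.sum fun j _ => (h j).mul (h j)
  rw [weight_eq u v, dirDeriv_add (contDiff_const.mul (h1.sub hu)) (contDiff_const.mul h2),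
    dirDeriv_const_mul (h1.sub hu), dirDeriv_const_mul h2, dirDeriv_sub h1 hu,
    dirDeriv_sum fun j => (hl j).mul (h j), dirDeriv_sum fun j => (h j).mul (h j)]
  ext x
  simp_rw [dirDeriv_mul (h _) (h _), dirDeriv_mul (hl _) (h _), dirDeriv_clm,
    Finset.sum_add_distrib]
  -- Differentiating x in x·Du gives back the gradient, which the −u cancels; the derivative of the
  -- weight therefore contains the Hessian in every term.
  have h3 : ∑ j, innerSL ℝ (v j) (v k) * dirDeriv (v j) u x = dirDeriv (v k) u x := by
    simp [orthonormal_iff_ite.1 v.orthonormal]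
  rw [h3]
  simp_rw [mul_comm (dirDeriv (v k) (dirDeriv _ u) x) (dirDeriv _ u x)]
  ring

lemma dirDeriv_dirDeriv_weight (hu : ContDiff ℝ ∞ u) (v : OrthonormalBasis (Fin n) ℝ (E n))
    (α β : ℝ) (k : Fin n) (x : E n) :
    dirDeriv (v k) (dirDeriv (v k) (weight u α β)) x =
      α * (dirDeriv (v k) (dirDeriv (v k) u) x +
        ∑ j, innerSL ℝ (v j) x * dirDeriv (v k) (dirDeriv (v k) (dirDeriv (v j) u)) x) +
      β * (∑ j, dirDeriv (v k) (dirDeriv (v j) u) x ^ 2 +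
        ∑ j, dirDeriv (v j) u x * dirDeriv (v k) (dirDeriv (v k) (dirDeriv (v j) u)) x) := by
  have h := fun j => contDiff_dirDeriv hu (v j)
  have h' := fun j => contDiff_dirDeriv (h j) (v k)
  have hl : ∀ j, ContDiff ℝ ∞ (innerSL ℝ (v j)) := fun j => ContinuousLinearMap.contDiff _
  have h1 : ContDiff ℝ ∞ fun x => ∑ j, innerSL ℝ (v j) x * dirDeriv (v k) (dirDeriv (v j) u) x :=
    ContDiff.sum fun j _ => (hl j).mul (h' j)
  have h2 : ContDiff ℝ ∞ fun x => ∑ j, dirDeriv (v j) u x * dirDeriv (v k) (dirDeriv (v j) u) x :=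
    ContDiff.sum fun j _ => (h j).mul (h' j)
  rw [dirDeriv_weight hu v, dirDeriv_add (contDiff_const.mul h1) (contDiff_const.mul h2),
    dirDeriv_const_mul h1, dirDeriv_const_mul h2,
    dirDeriv_sum fun j => (hl j).mul (h' j), dirDeriv_sum fun j => (h j).mul (h' j)]
  simp_rw [dirDeriv_mul (h _) (h' _), dirDeriv_mul (hl _) (h' _), dirDeriv_clm,
    Finset.sum_add_distrib]
  have h3 : ∑ j, innerSL ℝ (v j) (v k) * dirDeriv (v k) (dirDeriv (v j) u) x =
      dirDeriv (v k) (dirDeriv (v k) u) x := by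
    simp [orthonormal_iff_ite.1 v.orthonormal]
  rw [h3]
  simp_rw [← pow_two]
  ring

/-- The test function `ρ² exp(α (x·Du - u) + β |Du|² / 2) (log Δu - m)`. -/
noncomputable def testFunction (u : E n → ℝ) (α β m : ℝ) (x : E n) : ℝ :=
  (25 / 4 - ‖x‖ ^ 2) ^ 2 * Real.exp (weight u α β x) * (Real.log (Δ u x) - m)

lemma testFunction_first_second (hu : ContDiff ℝ ∞ u) {v : OrthonormalBasis (Fin n) ℝ (E n)}
    {lam : Fin n → ℝ} {p : E n}
    (hdiag : ∀ i j, dirDeriv (v i) (dirDeriv (v j) u) p = if i = j then lam i else 0)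
    {α β m σ b ρ : ℝ} (hσ : σ = Δ u p) (hσ0 : 0 < σ) (hb : b = Real.log σ - m) (hb0 : 0 < b)
    (hρ : ρ = 25 / 4 - ‖p‖ ^ 2) (hρ0 : 0 < ρ) (hmax : IsLocalMax (testFunction u α β m) p)
    {g : Fin n → ℝ} (hg : ∀ k, dirDeriv (v k) (Δ u) p = σ * b * g k) (k : Fin n) :
    g k = 4 * innerSL ℝ (v k) p / ρ -
      (α * innerSL ℝ (v k) p + β * dirDeriv (v k) u p) * lam k ∧
    -4 / ρ - 8 * innerSL ℝ (v k) p ^ 2 / ρ ^ 2 +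
      (α * (lam k + ∑ j, innerSL ℝ (v j) p *
          dirDeriv (v k) (dirDeriv (v k) (dirDeriv (v j) u)) p) +
        β * (lam k ^ 2 + ∑ j, dirDeriv (v j) u p *
          dirDeriv (v k) (dirDeriv (v k) (dirDeriv (v j) u)) p)) +
      dirDeriv (v k) (dirDeriv (v k) (Δ u)) p / (σ * b) - b * g k ^ 2 - g k ^ 2 ≤ 0 := by
  have hline : Continuous fun s : ℝ => p + s • v k := by fun_prop
  have hmax' : IsLocalMax (fun s : ℝ => testFunction u α β m (p + s • v k)) 0 := by
    have h1 : Tendsto (fun s : ℝ => p + s • v k) (𝓝 0) (𝓝 p) := by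
      simpa using hline.tendsto 0
    filter_upwards [h1.eventually hmax] with s hs
    simpa using hs
  have hnorm : ∀ s : ℝ, 25 / 4 - ‖p + s • v k‖ ^ 2 =
      25 / 4 - ‖p‖ ^ 2 - 2 * s * innerSL ℝ (v k) p - s ^ 2 := by
    intro s
    have hv : ‖v k‖ = 1 := v.orthonormal.1 k
    have hin : inner ℝ p (s • v k) = s * innerSL ℝ (v k) p := by
      rw [inner_smul_right, real_inner_comm]; rfl
    rw [norm_add_sq_real, norm_smul, hv, hin, mul_one, Real.norm_eq_abs, sq_abs]
    ring
  have hr : ∀ s : ℝ, HasDerivAt (fun s : ℝ => 25 / 4 - ‖p + s • v k‖ ^ 2)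
      (-2 * innerSL ℝ (v k) p - 2 * s) s := by
    intro s
    simp_rw [hnorm]
    have h1 := ((hasDerivAt_id s).const_mul 2).mul_const (innerSL ℝ (v k) p)
    have h2 := hasDerivAt_pow 2 s
    have h3 := (h1.const_sub (25 / 4 - ‖p‖ ^ 2)).sub h2
    refine h3.congr_deriv ?_
    simp
  have hr1 : HasDerivAt (fun s : ℝ => -2 * innerSL ℝ (v k) p - 2 * s) (-2) 0 := by
    have h1 := ((hasDerivAt_id (0 : ℝ)).const_mul 2).const_sub (-2 * innerSL ℝ (v k) p)
    refine h1.congr_deriv ?_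
    simp
  have hw := smooth_weight hu α β
  have hL := smooth_laplacian hu
  have hS1 := hasDerivAt_dirDeriv (contDiff_dirDeriv hL (v k)) p (v k) 0
  have hw1 := hasDerivAt_dirDeriv (contDiff_dirDeriv hw (v k)) p (v k) 0
  have hkey := local_max_log_test (m := m) hr hr1 (hasDerivAt_dirDeriv hw p (v k)) hw1
    (hasDerivAt_dirDeriv hL p (v k)) hS1 (by simpa [← hρ] using hρ0)
    (by simpa [← hσ] using hσ0) (by simpa [← hσ, ← hb] using hb0) hmax'
  simp only [zero_smul, add_zero, mul_zero, sub_zero, ← hσ, ← hb, ← hρ] at hkey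
  rw [dirDeriv_dirDeriv_weight hu v, hg] at hkey
  have hwp : dirDeriv (v k) (weight u α β) p =
      (α * innerSL ℝ (v k) p + β * dirDeriv (v k) u p) * lam k := by
    rw [dirDeriv_weight hu v]
    simp only [hdiag, mul_ite, mul_zero, Finset.sum_ite_eq, Finset.mem_univ, if_true]
    ring
  have hsq : ∑ j, dirDeriv (v k) (dirDeriv (v j) u) p ^ 2 = lam k ^ 2 := by
    simp [hdiag]
  have hkk : dirDeriv (v k) (dirDeriv (v k) u) p = lam k := by simp [hdiag]
  rw [hwp, hsq, hkk] at hkey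
  obtain ⟨h1, h2⟩ := hkey
  have e1 : σ * b * g k / σ / b = g k := by field_simp
  rw [e1] at h1
  constructor
  · have : 4 * innerSL ℝ (v k) p / ρ = -(2 * (-2 * innerSL ℝ (v k) p / ρ)) := by ring
    rw [this]
    linarith
  · refine le_trans (le_of_eq ?_) h2
    field_simp
    ring

lemma constants_bounds (hn : 4 ≤ n) {L C η K : ℝ} (hL : 1 ≤ L)
    (hC : C = 200000 * n * L ^ 3) (hη : η * (100000 * n ^ 3 * C) = 1)
    (hK : K * η ^ 2 = 1000000 * n ^ 2 * L * C) :
    0 < η ∧ 1000 * (n * η) ≤ 1 ∧ 1000 * η ≤ 1 ∧ 1000000 * L ≤ K := by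
  have hn' : (4 : ℝ) ≤ n := by exact_mod_cast hn
  have hC1 : 1 ≤ C := by
    have : (1 : ℝ) ≤ L ^ 3 := one_le_pow₀ hL
    rw [hC]
    nlinarith
  have hη0 : 0 < η := by
    by_contra! hcon
    have : η * (100000 * n ^ 3 * C) ≤ 0 := mul_nonpos_of_nonpos_of_nonneg hcon (by positivity)
    linarith
  have hn3 : (n : ℝ) ≤ n ^ 3 := le_self_pow₀ (by linarith) (by norm_num)
  have hnη : 1000 * (n * η) ≤ 1 := by
    calc 1000 * (n * η) = η * (1000 * n * 1) := by ring
      _ ≤ η * (100000 * n ^ 3 * C) := by gcongr; norm_num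
      _ = 1 := hη
  have hη1 : 1000 * η ≤ 1 := by
    have : 1 * η ≤ n * η := by gcongr; linarith
    linarith
  have hKL : 1000000 * L ≤ K := by
    have h1 : 1000000 * 1 * L * 1 ≤ 1000000 * (n : ℝ) ^ 2 * L * C := by
      gcongr
      exact one_le_pow₀ (by linarith)
    have hK0 : 0 ≤ K := by
      by_contra! hcon
      have : K * η ^ 2 ≤ 0 := mul_nonpos_of_nonpos_of_nonneg hcon.le (by positivity)
      linarith
    have h2 : K * η ^ 2 ≤ K * 1 := by
      gcongr
      exact pow_le_one₀ hη0.le (by linarith)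
    linarith
  exact ⟨hη0, hnη, hη1, hKL⟩

/-- The test function has no large interior local maximum away from the unit ball. -/
lemma not_isLocalMax_of_large (hn : 4 ≤ n) (hu : ContDiff ℝ ∞ u) {f : E n × ℝ × E n → ℝ}
    {U : Set (E n × ℝ × E n)} {p : E n} {L Γ C η K α β m : ℝ} (hL : 1 ≤ L) (hΓ : 1 ≤ Γ)
    (hC : C = 200000 * n * L ^ 3) (hη : η * (100000 * n ^ 3 * C) = 1)
    (hK : K * η ^ 2 = 1000000 * n ^ 2 * L * C)
    (hβ : β * Γ ^ 2 = η) (hα : α = 2 * n * β * Γ)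
    (hU : ∀ᶠ x in 𝓝 p, jet u x ∈ U) (hf : ∀ y ∈ U, DifferentiableAt ℝ f y)
    (hDf : ∀ y ∈ U, ‖fderiv ℝ f y‖ ≤ L)
    (hLip : ∀ y ∈ U, ∀ z ∈ U, ‖fderiv ℝ f y - fderiv ℝ f z‖ ≤ L * ‖y - z‖)
    (heq : ∀ᶠ x in 𝓝 p, sigma 2 u x = f (jet u x))
    (h0 : 1 ≤ L * sigma 2 u p) (hσ0 : 0 < Δ u p)
    (hdyn : n = 4 ∨ -dynConst n * Δ u p ≤ lambdaMin u p)
    (hgrad : ‖∇ u p‖ ≤ Γ) (hp1 : 1 ≤ ‖p‖) (hp : ‖p‖ < 5 / 2)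
    (hb0 : 0 < Real.log (Δ u p) - m) (hσb : Real.log (Δ u p) - m ≤ L * Δ u p)
    (hb : K * Γ ^ 2 ≤ (Real.log (Δ u p) - m) * (25 / 4 - ‖p‖ ^ 2) ^ 2) :
    ¬ IsLocalMax (testFunction u α β m) p := by
  intro hmax
  obtain ⟨v, lam, hdiag', heig⟩ := exists_eigenframe hu p
  have hdiag : ∀ i j, dirDeriv (v i) (dirDeriv (v j) u) p = if i = j then lam i else 0 := by
    intro i j
    rw [dirDeriv_dirDeriv hu, hdiag']
  obtain ⟨σ, hσ⟩ : ∃ σ, σ = Δ u p := ⟨_, rfl⟩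
  obtain ⟨b, hbd⟩ : ∃ b, b = Real.log σ - m := ⟨_, rfl⟩
  obtain ⟨ρ, hρ⟩ : ∃ ρ, ρ = 25 / 4 - ‖p‖ ^ 2 := ⟨_, rfl⟩
  have hρ0 : 0 < ρ := by rw [hρ]; nlinarith [norm_nonneg p]
  have hρ9 : ρ ≤ 9 := by rw [hρ]; nlinarith [norm_nonneg p]
  have hρ81 : ρ ^ 2 ≤ 81 := by nlinarith
  rw [← hσ] at hσ0 hb0 hσb hb hdyn
  rw [← hbd] at hb0 hσb hb
  rw [← hρ] at hb
  have hL0 : 0 < L := by linarith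
  have hn' : (4 : ℝ) ≤ n := by exact_mod_cast hn
  have hσl : σ = ∑ i, lam i := by
    rw [hσ, laplacian_eq_sum hu v]
    simp [hdiag]
  have hh : 2 * sigma 2 u p = σ ^ 2 - ∑ i, lam i ^ 2 := by
    rw [two_mul_sigma_two hu v, hσ]
    simp [hdiag]
  have hh0 : 0 < sigma 2 u p := by
    by_contra! hcon
    nlinarith
  have hk : ∀ k, -dynConst n * σ ≤ lam k := by
    rcases hdyn with h4 | h5
    · subst h4
      intro k
      rw [dynConst_four]
      exact neg_half_sum_le hσl hσ0 hh hh0 k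
    · intro k
      exact h5.trans (lambdaMin_le heig k)
  obtain ⟨hη0, hnη, hη1, hKL⟩ := constants_bounds hn hL hC hη hK
  have hβ0 : 0 < β := by
    by_contra! hcon
    have : β * Γ ^ 2 ≤ 0 := mul_nonpos_of_nonpos_of_nonneg hcon (by positivity)
    linarith
  have hΓ2 : 1 ≤ Γ ^ 2 := one_le_pow₀ hΓ
  have hb81 : K * Γ ^ 2 ≤ 81 * b := by
    have : b * ρ ^ 2 ≤ b * 81 := by gcongr
    linarith
  have hb2 : 1000000 * L * Γ ^ 2 ≤ 81 * b := by
    have : 1000000 * L * Γ ^ 2 ≤ K * Γ ^ 2 := by gcongr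
    linarith
  -- Largeness of b passes to σ through b ≤ Lσ.
  have hσΓ : Γ ^ 2 ≤ σ := by
    have h1 : L * Γ ^ 2 ≤ L * σ := by
      have : 0 < L * Γ ^ 2 := by positivity
      linarith
    exact le_of_mul_le_mul_left h1 hL0
  have hΓσ : Γ ≤ σ := (le_self_pow₀ hΓ two_ne_zero).trans hσΓ
  have hσ1 : 1 ≤ σ := by linarith
  have hb1 : 1 ≤ b := by
    have : 1 * 1 ≤ L * Γ ^ 2 := mul_le_mul hL hΓ2 zero_le_one hL0.le
    linarith
  obtain ⟨Ax, a, Az, hAx, ha, hAz, hg1, hg2⟩ := rhs_frame hu hU hf hDf hLip heq hdiag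
  have hin : ∀ (w : E n) k, |innerSL ℝ (v k) w| ≤ ‖w‖ := by
    intro w k
    have h1 := abs_real_inner_le_norm (v k) w
    rwa [v.orthonormal.1 k, one_mul] at h1
  have hx : ∀ k, |innerSL ℝ (v k) p| ≤ 3 := fun k => (hin p k).trans (by linarith)
  have hx1 : 1 ≤ ∑ k, innerSL ℝ (v k) p ^ 2 := by
    have h1 := v.sum_sq_norm_inner_right p
    simp only [Real.norm_eq_abs, sq_abs] at h1
    have h2 : ∑ k, innerSL ℝ (v k) p ^ 2 = ‖p‖ ^ 2 := h1
    rw [h2]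
    exact one_le_pow₀ hp1
  have huk : ∀ k, |dirDeriv (v k) u p| ≤ Γ := by
    intro k
    have h1 := hin (∇ u p) k
    have h2 : innerSL ℝ (v k) (∇ u p) = dirDeriv (v k) u p := by
      rw [innerSL_apply_apply, real_inner_comm, inner_gradient_left]
      rfl
    rw [h2] at h1
    exact h1.trans hgrad
  obtain ⟨g, hg⟩ : ∃ g : Fin n → ℝ, ∀ k, dirDeriv (v k) (Δ u) p = σ * b * g k :=
    ⟨fun k => dirDeriv (v k) (Δ u) p / (σ * b), fun k => by field_simp⟩
  have hfs := testFunction_first_second hu hdiag hσ hσ0 hbd hb0 hρ hρ0 hmax hg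
  have hg' : ∀ k, ∑ i, dirDeriv (v i) (dirDeriv (v i) (dirDeriv (v k) u)) p = σ * b * g k := by
    intro k
    rw [← hg, dirDeriv_laplacian hu v]
  have hα0 : 0 ≤ α := by rw [hα]; positivity
  have hαΓ : α * Γ ≤ 2 := by
    have : α * Γ = 2 * (n * η) := by rw [hα, ← hβ]; ring
    linarith
  have h1 := critical_point_ineq
    (T := fun i j k => dirDeriv (v i) (dirDeriv (v j) (dirDeriv (v k) u)) p)
    (τ := fun k => dirDeriv (v k) (dirDeriv (v k) (Δ u)) p)
    hn hσl hσ1 hh hk (third_symm_left hu) (third_symm_right hu) hL h0 hΓ hΓσ hb1 hρ0 hρ9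
    (by linarith) hα0 hβ0.le hαΓ (by rw [hβ]; linarith) hx huk hAx ha hAz
    (fun k => by rw [← hg1, dirDeriv_sigma_two_frame hu hdiag, hσ])
    hg' (by
      rw [hσ, ← sum_dirDeriv_dirDeriv_sigma_two_frame hu hdiag]
      exact hg2)
    (fun k => (hfs k).1) (fun k => (hfs k).2)
  have h2 := critical_point_bound hn hσl hσ1 hh hk hL h0 hΓ hρ0 hρ9 hb hσb hC hη hK hβ hα hx hx1
    huk (fun k => (hfs k).1)
  rw [hC] at h2
  linarith

end MaximumPoint

/-! ### The doubling inequality -/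

section Doubling

variable {n : ℕ} {u : E n → ℝ}

lemma continuous_testFunction_on (hu : ContDiff ℝ ∞ u) {s : Set (E n)} (hs : ∀ x ∈ s, 0 < Δ u x)
    (α β m : ℝ) : ContinuousOn (testFunction u α β m) s := by
  have h1 : ContinuousOn (fun x => Real.log (Δ u x) - m) s :=
    ((smooth_laplacian hu).continuous.continuousOn.log fun x hx => (hs x hx).ne').sub
      continuousOn_const
  have h2 : Continuous fun x : E n => (25 / 4 - ‖x‖ ^ 2) ^ 2 * Real.exp (weight u α β x) := by
    have := (smooth_weight hu α β).continuous
    fun_prop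
  exact h2.continuousOn.mul h1

lemma abs_weight_le {α β Γ N : ℝ} {x : E n} (hα : 0 ≤ α) (hβ : 0 ≤ β) (hN : N ≤ Γ) (hN0 : 0 ≤ N)
    (hx : ‖x‖ ≤ 3) (hux : |u x| ≤ N) (hgrad : ‖∇ u x‖ ≤ N) :
    |weight u α β x| ≤ 4 * (α * Γ) + β * Γ ^ 2 := by
  have h1 : |fderiv ℝ u x x| ≤ N * 3 := by
    rw [← inner_gradient_left]
    exact (abs_real_inner_le_norm _ _).trans (mul_le_mul hgrad hx (norm_nonneg _) hN0)
  have h2 : |fderiv ℝ u x x - u x| ≤ 4 * Γ := by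
    refine (abs_sub _ _).trans ?_
    linarith
  have h3 : |α * (fderiv ℝ u x x - u x)| ≤ α * (4 * Γ) := by
    rw [abs_mul, abs_of_nonneg hα]; gcongr
  have h4 : |β / 2 * ‖∇ u x‖ ^ 2| ≤ β / 2 * Γ ^ 2 := by
    rw [abs_of_nonneg (by positivity)]
    gcongr
    exact hgrad.trans hN
  have h5 : 0 ≤ β * Γ ^ 2 := by positivity
  refine (abs_add_le _ _).trans ?_
  linarith

/-- Transfers largeness from a point of B_2 to the maximum point. There ρ² ≥ (9/4)² = 81/16, and the
weight lies in [−1, 1], so the loss e² ≤ 81/8 is covered by the factor 2. -/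
lemma le_of_exp_le {a b r : ℝ} (hb : 0 ≤ b)
    (h : 81 / 16 * Real.exp (-1) * (2 * a) ≤ r ^ 2 * Real.exp 1 * b) : a ≤ b * r ^ 2 := by
  have h3 : Real.exp 1 * Real.exp (-1) = 1 := by rw [← Real.exp_add]; simp
  have h5 := Real.exp_pos 1
  have h6 : 81 / 8 * a ≤ (Real.exp 1 * Real.exp 1) * (b * r ^ 2) := by
    calc 81 / 8 * a = Real.exp 1 * (81 / 16 * Real.exp (-1) * (2 * a)) := by
          linear_combination (-81 / 8 * a) * h3
      _ ≤ Real.exp 1 * (r ^ 2 * Real.exp 1 * b) := by gcongr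
      _ = _ := by ring
  have h7 : Real.exp 1 * Real.exp 1 ≤ 81 / 8 := by
    have h4 : Real.exp 1 ≤ 3 := by linarith [Real.exp_one_lt_d9]
    nlinarith
  have h9 : Real.exp 1 * Real.exp 1 * (b * r ^ 2) ≤ 81 / 8 * (b * r ^ 2) := by gcongr
  linarith

set_option maxHeartbeats 800000 in
/-- The doubling inequality for a globally defined smooth function. -/
lemma laplacian_le_of_smooth (hn : 4 ≤ n) (hu : ContDiff ℝ ∞ u) {f : E n × ℝ × E n → ℝ}
    {U : Set (E n × ℝ × E n)} {L N Γ C η K M : ℝ} (hL : 1 ≤ L) (hN : 0 ≤ N) (hΓ : Γ = 1 + N)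
    (hC : C = 200000 * n * L ^ 3) (hη : η * (100000 * n ^ 3 * C) = 1)
    (hK : K * η ^ 2 = 1000000 * n ^ 2 * L * C)
    (hU : ∀ x ∈ Metric.ball (0 : E n) (14 / 5), jet u x ∈ U)
    (hf : ∀ y ∈ U, DifferentiableAt ℝ f y) (hDf : ∀ y ∈ U, ‖fderiv ℝ f y‖ ≤ L)
    (hLip : ∀ y ∈ U, ∀ z ∈ U, ‖fderiv ℝ f y - fderiv ℝ f z‖ ≤ L * ‖y - z‖)
    (heq : ∀ x ∈ Metric.ball (0 : E n) (14 / 5), sigma 2 u x = f (jet u x))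
    (h0 : ∀ x ∈ Metric.ball (0 : E n) (14 / 5), 1 ≤ L * sigma 2 u x)
    (hσ0 : ∀ x ∈ Metric.ball (0 : E n) (14 / 5), 0 < Δ u x)
    (hdyn : ∀ x ∈ Metric.ball (0 : E n) (14 / 5), n = 4 ∨ -dynConst n * Δ u x ≤ lambdaMin u x)
    (hux : ∀ x ∈ Metric.ball (0 : E n) (14 / 5), |u x| ≤ N)
    (hgrad : ∀ x ∈ Metric.ball (0 : E n) (14 / 5), ‖∇ u x‖ ≤ N)
    (hM0 : 0 < M) (hML : 1 ≤ L * M) (hM : ∀ x ∈ Metric.ball (0 : E n) 1, Δ u x ≤ M)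
    {x : E n} (hx : x ∈ Metric.ball (0 : E n) 2) :
    Δ u x ≤ M * Real.exp (2 * K * Γ ^ 2) := by
  by_contra! hcon
  have hn' : (4 : ℝ) ≤ n := by exact_mod_cast hn
  have hL0 : 0 < L := by linarith
  have hΓ1 : 1 ≤ Γ := by linarith
  obtain ⟨hη0, hnη, hη1, hKL⟩ := constants_bounds hn hL hC hη hK
  have hK0 : 0 < K := by linarith
  -- Scaling by Γ keeps the weight bounded by 1 whatever the size of u in C¹, while α stays 2nΓ
  -- times β.
  obtain ⟨β, hβ⟩ : ∃ β, β = η / Γ ^ 2 := ⟨_, rfl⟩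
  obtain ⟨α, hα⟩ : ∃ α, α = 2 * n * β * Γ := ⟨_, rfl⟩
  have hβ0 : 0 < β := by rw [hβ]; positivity
  have hβΓ : β * Γ ^ 2 = η := by rw [hβ]; field_simp
  have hα0 : 0 ≤ α := by rw [hα]; positivity
  have hαΓ : α * Γ = 2 * (n * η) := by rw [hα, ← hβΓ]; ring
  have hw : ∀ y : E n, ‖y‖ ≤ 5 / 2 → |weight u α β y| ≤ 1 := by
    intro y hy
    have hyB : y ∈ Metric.ball (0 : E n) (14 / 5) := by
      rw [mem_ball_zero_iff]; linarith
    have := abs_weight_le hα0 hβ0.le (by linarith : N ≤ Γ) hN (by linarith) (hux y hyB)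
      (hgrad y hyB)
    rw [hαΓ, hβΓ] at this
    linarith
  obtain ⟨m, hm⟩ : ∃ m, m = Real.log M := ⟨_, rfl⟩
  have hsub : ∀ y ∈ Metric.closedBall (0 : E n) (5 / 2), y ∈ Metric.ball (0 : E n) (14 / 5) := by
    intro y hy
    rw [mem_closedBall_zero_iff] at hy
    rw [mem_ball_zero_iff]; linarith
  have hx2 : ‖x‖ < 2 := by rwa [mem_ball_zero_iff] at hx
  have hxc : x ∈ Metric.closedBall (0 : E n) (5 / 2) := by
    rw [mem_closedBall_zero_iff]; linarith
  obtain ⟨p, hp, hpmax⟩ := (isCompact_closedBall (0 : E n) (5 / 2)).exists_isMaxOn ⟨x, hxc⟩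
    (continuous_testFunction_on hu (fun y hy => hσ0 y (hsub y hy)) α β m)
  have hpB := hsub p hp
  rw [mem_closedBall_zero_iff] at hp
  have hbx : 2 * K * Γ ^ 2 < Real.log (Δ u x) - m := by
    have h1 := Real.log_lt_log (by positivity) hcon
    rw [Real.log_mul hM0.ne' (Real.exp_ne_zero _), Real.log_exp] at h1
    linarith
  have hKΓ : 0 < K * Γ ^ 2 := by positivity
  have hρx : 81 / 16 ≤ (25 / 4 - ‖x‖ ^ 2) ^ 2 := by
    have h1 : 9 / 4 ≤ 25 / 4 - ‖x‖ ^ 2 := by nlinarith [norm_nonneg x]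
    nlinarith
  have hex : Real.exp (-1) ≤ Real.exp (weight u α β x) :=
    Real.exp_le_exp.2 (neg_le_of_abs_le (hw x (by linarith)))
  have hep : Real.exp (weight u α β p) ≤ Real.exp 1 :=
    Real.exp_le_exp.2 (le_of_abs_le (hw p hp))
  have htx : 81 / 16 * Real.exp (-1) * (2 * (K * Γ ^ 2)) ≤ testFunction u α β m x := by
    unfold testFunction
    gcongr
    linarith
  have htp : testFunction u α β m x ≤ testFunction u α β m p := hpmax hxc
  have hpos : 0 < testFunction u α β m p := by
    have : 0 < 81 / 16 * Real.exp (-1) * (2 * (K * Γ ^ 2)) := by positivity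
    linarith
  have hbp : 0 < Real.log (Δ u p) - m := by
    by_contra! h
    have : testFunction u α β m p ≤ 0 :=
      mul_nonpos_of_nonneg_of_nonpos (by positivity) h
    linarith
  have hp52 : ‖p‖ < 5 / 2 := by
    refine lt_of_le_of_ne hp fun h => ?_
    rw [testFunction, h] at hpos
    norm_num at hpos
  have hp1 : 1 ≤ ‖p‖ := by
    by_contra! h
    have h1 := hM p (by rwa [mem_ball_zero_iff])
    have h2 := Real.log_le_log (hσ0 p hpB) h1
    linarith
  -- log(Δu/M) ≤ Δu/M, and 1/M ≤ L.
  have hσb : Real.log (Δ u p) - m ≤ L * Δ u p := by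
    rw [hm, ← Real.log_div (hσ0 p hpB).ne' hM0.ne']
    refine (Real.log_le_self (div_pos (hσ0 p hpB) hM0).le).trans ?_
    rw [div_le_iff₀ hM0]
    nlinarith [hσ0 p hpB]
  have hlarge : K * Γ ^ 2 ≤ (Real.log (Δ u p) - m) * (25 / 4 - ‖p‖ ^ 2) ^ 2 := by
    have h1 : testFunction u α β m p ≤
        (25 / 4 - ‖p‖ ^ 2) ^ 2 * Real.exp 1 * (Real.log (Δ u p) - m) := by
      unfold testFunction
      gcongr
    exact le_of_exp_le hbp.le (htx.trans (htp.trans h1))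
  have hnhds : ∀ᶠ y in 𝓝 p, y ∈ Metric.ball (0 : E n) (14 / 5) :=
    Metric.isOpen_ball.mem_nhds hpB
  refine not_isLocalMax_of_large hn hu hL hΓ1 hC hη hK hβΓ hα (hnhds.mono hU) hf hDf hLip
    (hnhds.mono heq) (h0 p hpB) (hσ0 p hpB) (hdyn p hpB) ((hgrad p hpB).trans (by linarith)) hp1
    hp52 hbp hσb hlarge ?_
  exact hpmax.isLocalMax (Metric.closedBall_mem_nhds_of_mem (by rwa [mem_ball_zero_iff]))

end Doubling

/-! ### Localization -/

section Localization

lemma norm_le_of_supNorm_le {X Y : Type*} [NormedAddCommGroup Y] {g : X → Y} {U : Set X}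
    {c : ℝ≥0∞} (hc : c ≠ ⊤) (h : supNorm g U ≤ c) {x : X} (hx : x ∈ U) : ‖g x‖ ≤ c.toReal := by
  have h1 : ‖g x‖ₑ ≤ c := (le_iSup₂ (f := fun x (_ : x ∈ U) => ‖g x‖ₑ) x hx).trans h
  rw [← toReal_enorm]
  exact ENNReal.toReal_mono hc h1

lemma norm_sub_le_of_lipSeminorm_le {X Y : Type*} [NormedAddCommGroup X] [NormedAddCommGroup Y]
    {g : X → Y} {U : Set X} {c : ℝ≥0∞} (hc : c ≠ ⊤) (h : lipSeminorm g U ≤ c) {x y : X}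
    (hx : x ∈ U) (hy : y ∈ U) : ‖g x - g y‖ ≤ c.toReal * ‖x - y‖ := by
  by_cases hxy : x = y
  · simp [hxy]
  have h1 : ‖g x - g y‖ₑ / ‖x - y‖ₑ ≤ c := by
    refine le_trans ?_ h
    refine le_trans ?_ (le_iSup₂ (f := fun x (_ : x ∈ U) => ⨆ y ∈ U, ‖g x - g y‖ₑ / ‖x - y‖ₑ) x hx)
    exact le_iSup₂ (f := fun y (_ : y ∈ U) => ‖g x - g y‖ₑ / ‖x - y‖ₑ) y hy
  have hne : ‖x - y‖ₑ ≠ 0 := by simpa [sub_eq_zero] using hxy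
  rw [ENNReal.div_le_iff hne enorm_ne_top] at h1
  have h2 := ENNReal.toReal_mono (ENNReal.mul_ne_top hc enorm_ne_top) h1
  rwa [ENNReal.toReal_mul, toReal_enorm, toReal_enorm] at h2

variable {n : ℕ} {u w : E n → ℝ} {x : E n}

lemma hessian_congr (h : u =ᶠ[𝓝 x] w) : hessian u x = hessian w x := by
  ext i j
  rw [hessian_apply, hessian_apply, h.fderiv.fderiv_eq]

lemma sigma_congr (h : u =ᶠ[𝓝 x] w) (k : ℕ) : sigma k u x = sigma k w x := by
  rw [sigma, sigma, hessianEigenvalues, hessianEigenvalues, hessian_congr h]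

lemma lambdaMin_congr (h : u =ᶠ[𝓝 x] w) : lambdaMin u x = lambdaMin w x := by
  rw [lambdaMin, lambdaMin, hessianEigenvalues, hessianEigenvalues, hessian_congr h]

/-- A cutoff makes u globally smooth, so that derivatives can be commuted without domain conditions;
the radius 14/5 leaves room around the closed ball of radius 5/2. -/
lemma exists_smooth_extension (hu : ContDiffOn ℝ ∞ u (Metric.ball 0 3)) :
    ∃ w : E n → ℝ, ContDiff ℝ ∞ w ∧ ∀ x ∈ Metric.ball (0 : E n) (14 / 5), w =ᶠ[𝓝 x] u := by
  let χ : ContDiffBump (0 : E n) := ⟨14 / 5, 29 / 10, by norm_num, by norm_num⟩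
  refine ⟨fun x => χ x * u x, ?_, fun x hx => ?_⟩
  · rw [contDiff_iff_contDiffAt]
    intro x
    by_cases hx : ‖x‖ < 3
    · have hx' : x ∈ Metric.ball (0 : E n) 3 := by rwa [mem_ball_zero_iff]
      exact χ.contDiff.contDiffAt.mul (hu.contDiffAt (Metric.isOpen_ball.mem_nhds hx'))
    · have h1 : (fun x => χ x * u x) =ᶠ[𝓝 x] fun _ => 0 := by
        have h2 : ∀ᶠ y in 𝓝 x, (29 / 10 : ℝ) < ‖y‖ :=
          continuous_norm.continuousAt.eventually_const_lt (by push Not at hx; linarith)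
        filter_upwards [h2] with y hy
        have : χ y = 0 := χ.zero_of_le_dist (by rw [dist_zero_right]; exact hy.le)
        rw [this, zero_mul]
      exact contDiffAt_const.congr_of_eventuallyEq h1
  · filter_upwards [Metric.isOpen_ball.mem_nhds hx] with y hy
    have : χ y = 1 := χ.one_of_mem_closedBall (Metric.ball_subset_closedBall hy)
    rw [this, one_mul]

end Localization

end SigmaTwo

/-! ### Proof of the theorem -/

theorem proposition3p1 (n : ℕ) (Λ κ : ℝ≥0) :
    ∃ C : ℝ, 0 < C ∧
      ∀ (f : SigmaTwo.E n × ℝ × SigmaTwo.E n → ℝ) (u : SigmaTwo.E n → ℝ),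
        SigmaTwo.IsC11On f (Metric.ball 0 3 ×ˢ Set.univ) →
        (∀ w ∈ Metric.ball (0 : SigmaTwo.E n) 3 ×ˢ (Set.univ : Set (ℝ × SigmaTwo.E n)),
          0 < f w) →
        SigmaTwo.c11Norm f (Metric.ball 0 3 ×ˢ Set.univ) ≤ Λ →
        SigmaTwo.supNorm (fun w => 1 / f w) (Metric.ball 0 3 ×ˢ Set.univ) ≤ κ →
        SigmaTwo.IsSmoothAdmissibleSolution f u (Metric.ball 0 3) →
        SigmaTwo.c1Norm u (Metric.ball 0 3) ≠ ⊤ →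
        (n = 4 ∨ 5 ≤ n ∧ SigmaTwo.IsDynSemiconvexOn u (Metric.ball 0 3)) →
        BddAbove (Δ u '' Metric.ball 0 2) ∧
        sSup (Δ u '' Metric.ball 0 2) ≤
          C * Real.exp (C * (SigmaTwo.c1Norm u (Metric.ball 0 3)).toReal ^ 6) *
            sSup (Δ u '' Metric.ball 0 1) := by
  by_cases hn : 4 ≤ n
  swap
  · exact ⟨1, one_pos, fun f u _ _ _ _ _ _ h => by omega⟩
  have hn' : (4 : ℝ) ≤ n := by exact_mod_cast hn
  obtain ⟨L, hLdef⟩ : ∃ L : ℝ, L = 1 + Λ + κ := ⟨_, rfl⟩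
  have hΛL : (Λ : ℝ) ≤ L := by rw [hLdef]; linarith [κ.coe_nonneg]
  have hκL : (κ : ℝ) ≤ L := by rw [hLdef]; linarith [Λ.coe_nonneg]
  have hL : 1 ≤ L := by rw [hLdef]; linarith [Λ.coe_nonneg, κ.coe_nonneg]
  have hL0 : 0 < L := by linarith
  obtain ⟨C, hC⟩ : ∃ C : ℝ, C = 200000 * n * L ^ 3 := ⟨_, rfl⟩
  have hC0 : 0 < C := by rw [hC]; positivity
  obtain ⟨η, hη⟩ : ∃ η : ℝ, η = 1 / (100000 * n ^ 3 * C) := ⟨_, rfl⟩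
  have hη0 : 0 < η := by rw [hη]; positivity
  obtain ⟨K, hK⟩ : ∃ K : ℝ, K = 1000000 * n ^ 2 * L * C / η ^ 2 := ⟨_, rfl⟩
  have hK0 : 0 < K := by rw [hK]; positivity
  -- This single constant serves as the prefactor, absorbing exp(8K), and in the exponent, where it
  -- exceeds 4K.
  refine ⟨Real.exp (8 * K), Real.exp_pos _, fun f u hf hfpos hfΛ hfκ hsol hN hdyn => ?_⟩
  obtain ⟨w, hw, hwu⟩ := SigmaTwo.exists_smooth_extension hsol.smooth
  obtain ⟨N, hNdef⟩ : ∃ N, N = (SigmaTwo.c1Norm u (Metric.ball 0 3)).toReal := ⟨_, rfl⟩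
  have hN0 : 0 ≤ N := by rw [hNdef]; exact ENNReal.toReal_nonneg
  have hB : ∀ x ∈ Metric.ball (0 : SigmaTwo.E n) (14 / 5), x ∈ Metric.ball (0 : SigmaTwo.E n) 3 :=
    fun x hx => Metric.ball_subset_ball (by norm_num) hx
  have hjet : ∀ x ∈ Metric.ball (0 : SigmaTwo.E n) (14 / 5),
      SigmaTwo.jet w x = (x, u x, ∇ u x) := fun x hx => by
    rw [SigmaTwo.jet, (hwu x hx).eq_of_nhds, (hwu x hx).gradient_eq]
  have hU : ∀ x ∈ Metric.ball (0 : SigmaTwo.E n) (14 / 5),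
      SigmaTwo.jet w x ∈ Metric.ball (0 : SigmaTwo.E n) 3 ×ˢ
        (Set.univ : Set (ℝ × SigmaTwo.E n)) := fun x hx => by
    rw [hjet x hx]; exact ⟨hB x hx, Set.mem_univ _⟩
  have hlap : ∀ x ∈ Metric.ball (0 : SigmaTwo.E n) (14 / 5), Δ w x = Δ u x := fun x hx =>
    (InnerProductSpace.laplacian_congr_nhds (hwu x hx)).eq_of_nhds
  have heq : ∀ x ∈ Metric.ball (0 : SigmaTwo.E n) (14 / 5),
      SigmaTwo.sigma 2 w x = f (SigmaTwo.jet w x) := fun x hx => by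
    rw [SigmaTwo.sigma_congr (hwu x hx), hjet x hx]; exact hsol.equation x (hB x hx)
  have h0 : ∀ x ∈ Metric.ball (0 : SigmaTwo.E n) (14 / 5), 1 ≤ L * SigmaTwo.sigma 2 w x := by
    intro x hx
    have h1 := SigmaTwo.norm_le_of_supNorm_le ENNReal.coe_ne_top hfκ (hU x hx)
    have h2 := hfpos _ (hU x hx)
    rw [Real.norm_eq_abs, abs_of_pos (by positivity), div_le_iff₀ h2] at h1
    rw [heq x hx]
    exact h1.trans (mul_le_mul_of_nonneg_right hκL h2.le)
  have hσ0 : ∀ x ∈ Metric.ball (0 : SigmaTwo.E n) (14 / 5), 0 < Δ w x := fun x hx => by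
    rw [← SigmaTwo.sigma_one_eq hw, SigmaTwo.sigma_congr (hwu x hx)]
    exact (hsol.admissible x (hB x hx)).1
  have hdyn' : ∀ x ∈ Metric.ball (0 : SigmaTwo.E n) (14 / 5),
      n = 4 ∨ -SigmaTwo.dynConst n * Δ w x ≤ SigmaTwo.lambdaMin w x := fun x hx => by
    rw [hlap x hx, SigmaTwo.lambdaMin_congr (hwu x hx)]
    exact hdyn.imp_right fun h => h.2 x (hB x hx)
  have hux : ∀ x ∈ Metric.ball (0 : SigmaTwo.E n) (14 / 5), |w x| ≤ N := fun x hx => by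
    rw [(hwu x hx).eq_of_nhds, hNdef]
    exact SigmaTwo.norm_le_of_supNorm_le hN le_self_add (hB x hx)
  have hgrad : ∀ x ∈ Metric.ball (0 : SigmaTwo.E n) (14 / 5), ‖∇ w x‖ ≤ N := fun x hx => by
    rw [(hwu x hx).gradient_eq, hNdef]
    exact SigmaTwo.norm_le_of_supNorm_le hN le_add_self (hB x hx)
  have himg : ∀ r : ℝ, r ≤ 2 → Δ u '' Metric.ball 0 r = Δ w '' Metric.ball 0 r := fun r hr =>
    Set.image_congr fun x hx => (hlap x (Metric.ball_subset_ball (by linarith) hx)).symm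
  have hbdd : ∀ r : ℝ, BddAbove (Δ w '' Metric.ball 0 r) := fun r =>
    ((isCompact_closedBall (0 : SigmaTwo.E n) r).bddAbove_image
      (SigmaTwo.smooth_laplacian hw).continuous.continuousOn).mono
      (Set.image_mono Metric.ball_subset_closedBall)
  rw [himg 2 le_rfl, himg 1 (by norm_num), ← hNdef]
  refine ⟨hbdd 2, ?_⟩
  obtain ⟨M, hMdef⟩ : ∃ M, M = sSup (Δ w '' Metric.ball 0 1) := ⟨_, rfl⟩
  rw [← hMdef]
  have hM : ∀ x ∈ Metric.ball (0 : SigmaTwo.E n) 1, Δ w x ≤ M := fun x hx => by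
    rw [hMdef]; exact le_csSup (hbdd 1) ⟨x, hx, rfl⟩
  have hz : (0 : SigmaTwo.E n) ∈ Metric.ball (0 : SigmaTwo.E n) (14 / 5) :=
    Metric.mem_ball_self (by norm_num)
  have hM1 := hM 0 (Metric.mem_ball_self one_pos)
  have hz0 := hσ0 0 hz
  have hM0 : 0 < M := hz0.trans_le hM1
  -- The equation bounds the trace from below: (Δu)² ≥ 2σ₂ ≥ 2/L at the origin.
  have hML : 1 ≤ L * M := by
    have h1 := SigmaTwo.two_mul_sigma_two hw (EuclideanSpace.basisFun (Fin n) ℝ) 0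
    have h2 : 2 * SigmaTwo.sigma 2 w 0 ≤ Δ w 0 ^ 2 := by
      rw [h1, sub_le_self_iff]
      positivity
    have h3 : 1 ≤ L * Δ w 0 := by
      have h4 : 1 ≤ (L * Δ w 0) ^ 2 := by
        have h5 := h0 0 hz
        have h6 : L ^ 2 * (2 * SigmaTwo.sigma 2 w 0) ≤ L ^ 2 * Δ w 0 ^ 2 := by gcongr
        have h7 : 1 * 1 ≤ L * (L * SigmaTwo.sigma 2 w 0) := mul_le_mul hL h5 zero_le_one hL0.le
        linarith
      exact (one_le_sq_iff₀ (by positivity)).1 h4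
    exact h3.trans (mul_le_mul_of_nonneg_left hM1 hL0.le)
  refine csSup_le ((Metric.nonempty_ball.2 two_pos).image _) ?_
  rintro _ ⟨x, hx, rfl⟩
  have hmain := SigmaTwo.laplacian_le_of_smooth hn hw hL hN0 rfl hC (η := η) (K := K)
    (by rw [hη]; field_simp) (by rw [hK]; field_simp) hU hf.1
    (fun y hy => (SigmaTwo.norm_le_of_supNorm_le ENNReal.coe_ne_top
      ((le_add_self.trans le_self_add).trans hfΛ) hy).trans hΛL)
    (fun y hy z hz => (SigmaTwo.norm_sub_le_of_lipSeminorm_le ENNReal.coe_ne_top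
      (le_add_self.trans hfΛ) hy hz).trans (mul_le_mul_of_nonneg_right hΛL (norm_nonneg _)))
    heq h0 hσ0 hdyn' hux hgrad hM0 hML hM hx
  refine hmain.trans ?_
  rw [mul_comm]
  refine mul_le_mul_of_nonneg_right ?_ hM0.le
  rw [← Real.exp_add]
  refine Real.exp_le_exp.2 ?_
  -- The argument yields an exponent quadratic in N; it is weakened here to the sixth power.
  have hN6 : N ^ 2 ≤ 1 + N ^ 6 := by
    have : 0 ≤ N ^ 2 := by positivity
    nlinarith [sq_nonneg (N ^ 2 - 1), mul_nonneg this (sq_nonneg (N ^ 2 - 1))]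
  have hΓ2 : (1 + N) ^ 2 ≤ 4 + 2 * N ^ 6 := by nlinarith [sq_nonneg (N - 1)]
  have h4K : 4 * K ≤ Real.exp (8 * K) := by linarith [Real.add_one_le_exp (8 * K)]
  have hN60 : 0 ≤ N ^ 6 := by positivity
  calc 2 * K * (1 + N) ^ 2 ≤ 2 * K * (4 + 2 * N ^ 6) := by gcongr
    _ = 8 * K + 4 * K * N ^ 6 := by ring
    _ ≤ 8 * K + Real.exp (8 * K) * N ^ 6 := by gcongr
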